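/- All vector spaces are over $\mathbb{C}$; $n\ge 1$ is a fixed integer, $\mathbf{x}=(x_1,\dots,x_n)$, and similarly $\mathbf{y},\mathbf{z}$; $\mathbf{x}^{\mathbf m}=x_1^{m_1}\cdots x_n^{m_n}$, and for $\mathbf m\in\mathbb{Z}^n$ we write $\mathbf{x}^{-\mathbf{m}-1}=\prod_i x_i^{-m_i-1}$, $(\mathbf{x}-\mathbf{y})^{\mathbf m}=\prod_i(x_i-y_i)^{m_i}$ (expanded in nonnegative powers of the $y_i$), and $(\mathbf{x}-\mathbf{y})^{k}=\prod_i(x_i-y_i)^{k}$ for $k\in\mathbb{Z}$. For a vector space $W$ put $W((\mathbf{x}))=W[[x_1,\dots,x_n]][x_1^{-1},\dots,x_n^{-1}]$. **Definitions.** A *$G_n$-vertex operator* on $W$ is a formal series $\psi(\mathbf{x})=\sum_{\mathbf{m}\in\mathbb{Z}^n}\psi_{\mathbf m}\mathbf{x}^{-\mathbf{m}-1}$ with $\psi_{\mathbf m}\in\mathrm{End}\,W$ such that $\psi(\mathbf{x})w\in W((\mathbf{x}))$ for all $w\in W$; these form a vector space $VO_{G_n}(W)$. Two of them, $\psi,\phi$,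 are *mutually local* if $(\mathbf{x}-\mathbf{y})^k\psi(\mathbf{x})\phi(\mathbf{y})=(\mathbf{x}-\mathbf{y})^k\phi(\mathbf{y})\psi(\mathbf{x})$ for some $k\in\mathbb{N}$. For $\alpha\in(\mathbb{F}_2)^n$ let $|\alpha|$ be the number of nonzero $\alpha_i$, and let $\iota_{\alpha,\mathbf{x},\mathbf{y}}((\mathbf{x}-\mathbf{y})^{\mathbf m})$ be the product over $i$ of the expansions of $(x_i-y_i)^{m_i}$ in nonnegative powers of $y_i$ if $\alpha_i=0$, and in nonnegative powers of $x_i$ if $\alpha_i=1$. If $f(\mathbf{x},\mathbf{y})$ is a series with coefficients in $\mathrm{End}\,W$ and $(\mathbf{x}-\mathbf{y})^kf(\mathbf{x},\mathbf{y})w\in W((\mathbf{x},\mathbf{y}))$ for all $w\in W$ and some $k\in\mathbb{N}$, put $$\iota_{\alpha,\mathbf{x},\mathbf{y}}(f(\mathbf{x},\mathbf{y}))w=\iota_{\alpha,\mathbf{x},\mathbf{y}}\big((\mathbf{x}-\mathbf{y})^{-k}\big)\big((\mathbf{x}-\mathbf{y})^kf(\mathbf{x},\mathbf{y})w\big),$$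 which does not depend on $k$; extend $\iota_{\alpha,\mathbf{x},\mathbf{y}}$ coefficientwise to series in $\mathbf{z}$. Write $\mathbf{z}^{-1}\delta\big(\tfrac{\mathbf{x}-\mathbf{y}}{\mathbf{z}}\big)=\sum_{\mathbf{m}\in\mathbb{Z}^n}(\mathbf{x}-\mathbf{y})^{\mathbf m}\mathbf{z}^{-\mathbf{m}-1}$. A *$G_n$-vertex algebra structure* on $V$ with vacuum vector $\mathbf{1}\in V$ is a linear map $v\mapsto Y(v,\mathbf{x})$ from $V$ to $VO_{G_n}(V)$ such that: $Y(\mathbf{1},\mathbf{x})=1$; for every $v\in V$, $Y(v,\mathbf{x})\mathbf{1}\in V[[\mathbf{x}]]$ has constant term $v$; for all $u,v\in V$ the operators $Y(u,\mathbf{x})$ and $Y(v,\mathbf{x})$ are mutually local; and for all $u,v\in V$ the Jacobi identity holds: $$\mathbf{y}^{-1}\delta\Big(\frac{\mathbf{x}-\mathbf{z}}{\mathbf{y}}\Big)Y(Y(u,\mathbf{z})v,\mathbf{y})=\sum_{\alpha\in(\mathbb{F}_2)^n}(-1)^{|\alpha|}\,\iota_{\alpha,\mathbf{x},\mathbf{y}}\Big(\mathbf{z}^{-1}\delta\Big(\frac{\mathbf{x}-\mathbf{y}}{\mathbf{z}}\Big)Y(u,\mathbf{x})Y(v,\mathbf{y})\Big).$$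 **Proposition.** Let $V$ be a vector space, $d_1,\dots,d_n\in\mathrm{End}\,V$, $\mathbf{1}\in V$, and let $U\subseteq V$ be a subspace with a linear map $Y:U\to VO_{G_n}(V)$, $u\mapsto Y(u,\mathbf{x})=\sum_{\mathbf m}u_{\mathbf m}\mathbf{x}^{-\mathbf{m}-1}$, such that 1. $V$ is generated from $\mathbf{1}$ by the operators $u_{\mathbf m}$ ($u\in U$, $\mathbf{m}\in\mathbb{Z}^n$), i.e. the only subspace of $V$ that contains $\mathbf{1}$ and is stable under all $u_{\mathbf m}$ is $V$; 2. for $u\in U$, $Y(u,\mathbf{x})\mathbf{1}\in V[[\mathbf{x}]]$ and its constant term is $u$; 3. $[d_i,Y(u,\mathbf{x})]=\partial_{x_i}Y(u,\mathbf{x})$ for $u\in U$, $1\le i\le n$; 4. for all $u,v\in U$ (including $u=v$), $Y(u,\mathbf{x})$ and $Y(v,\mathbf{x})$ are mutually local; 5. $d_i\mathbf{1}=0$ for $1\le i\le n$. Then there is a unique $G_n$-vertex algebra structure on $V$ with vacuum vector $\mathbf{1}$ whose vertex operator map extends the given map $Y$ on $U$. -/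

import Mathlib

namespace GnVertex

noncomputable section

/-- Formal series `∑_{m ∈ ℤⁿ} f(m) x^m` in `x = (x₁, …, xₙ)` with coefficients in `M`;
`f m` is the coefficient of `x^m = x₁^{m₁} ⋯ xₙ^{mₙ}`. -/
abbrev Series (n : ℕ) (M : Type*) := (Fin n → ℤ) → M

/-- Formal series in `x = (x₁, …, xₙ)` and `y = (y₁, …, yₙ)`;
`f a b` is the coefficient of `x^a y^b`. -/
abbrev Series₂ (n : ℕ) (M : Type*) := (Fin n → ℤ) → (Fin n → ℤ) → M

section Basic

variable {n : ℕ} {M : Type*} [AddCommGroup M] [Module ℂ M]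

/-- `f(x) ∈ M((x)) = M[[x₁, …, xₙ]][x₁⁻¹, …, xₙ⁻¹]`. -/
def IsLaurent (f : Series n M) : Prop :=
  ∃ N : ℤ, ∀ m, f m ≠ 0 → ∀ i, N ≤ m i

/-- `f(x, y) ∈ M((x, y))`. -/
def IsLaurent₂ (f : Series₂ n M) : Prop :=
  ∃ N : ℤ, ∀ a b, f a b ≠ 0 → ∀ i, N ≤ a i ∧ N ≤ b i

/-- `f(x) ∈ M[[x]]`: only nonnegative powers of the variables occur. -/
def IsPower (f : Series n M) : Prop :=
  ∀ m, f m ≠ 0 → ∀ i, 0 ≤ m i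

/-- The formal partial derivative `∂_{x_i}`. -/
def pderiv (i : Fin n) (f : Series n M) : Series n M :=
  fun m => ((m i + 1 : ℤ) : ℂ) • f (m + Pi.single i 1)

/-- The product `c(x, y) g(x, y)` of a scalar series and a series with coefficients in `M`.
It is only used where each coefficient is a finite sum. -/
def mulSeries (c : Series₂ n ℂ) (g : Series₂ n M) : Series₂ n M :=
  fun a b => ∑ᶠ p : (Fin n → ℤ) × (Fin n → ℤ), c p.1 p.2 • g (a - p.1) (b - p.2)

/-- The coefficient of `x^a y^b` (one variable each) in the expansion of `(x - y)^m`: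
for `ε = 0` the expansion `∑_{j ≥ 0} (m choose j) x^{m-j} (-y)^j`,
for `ε = 1` the expansion `∑_{j ≥ 0} (m choose j) (-y)^{m-j} x^j`. -/
def binomCoeff (ε : ZMod 2) (m a b : ℤ) : ℂ :=
  if a + b = m then
    if ε = 0 then
      if 0 ≤ b then (-1 : ℂ) ^ b * ((Ring.choose m b.toNat : ℤ) : ℂ) else 0
    else
      if 0 ≤ a then (-1 : ℂ) ^ b * ((Ring.choose m a.toNat : ℤ) : ℂ) else 0
  else 0

/-- The series `ι_{α,x,y}((x - y)^m) = ∏_i ι_{α,x,y}((x_i - y_i)^{m_i})` for `m ∈ ℤⁿ`. -/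
def iotaPow (α : Fin n → ZMod 2) (m : Fin n → ℤ) : Series₂ n ℂ :=
  fun a b => ∏ i, binomCoeff (α i) (m i) (a i) (b i)

/-- `(x - y)^m` for `m ∈ ℤⁿ`, expanded by the usual convention in nonnegative powers of `y`. -/
def subPow (m : Fin n → ℤ) : Series₂ n ℂ := iotaPow 0 m

/-- `(x - y)^k = ∏_i (x_i - y_i)^k` for a single `k ∈ ℤ`. -/
def subPowConst (n : ℕ) (k : ℤ) : Series₂ n ℂ := subPow (fun _ => k)

end Basic

section Operators

variable {n : ℕ} {W : Type*} [AddCommGroup W] [Module ℂ W]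

/-- The space `VO_{G_n}(W)` of `G_n`-vertex operators on `W`: series `ψ(x)` with coefficients
in `End W` such that `ψ(x) w ∈ W((x))` for every `w ∈ W`. -/
def VO (n : ℕ) (W : Type*) [AddCommGroup W] [Module ℂ W] :
    Submodule ℂ (Series n (Module.End ℂ W)) where
  carrier := {ψ | ∀ w, IsLaurent (fun m => ψ m w)}
  add_mem' := by
    intro ψ φ hψ hφ w
    obtain ⟨N, hN⟩ := hψ w
    obtain ⟨N', hN'⟩ := hφ w
    refine ⟨min N N', fun m hm i => ?_⟩
    by_cases h : ψ m w = 0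
    · have h' : φ m w ≠ 0 := by
        intro h'
        apply hm
        simp [h, h']
      exact (min_le_right _ _).trans (hN' m h' i)
    · exact (min_le_left _ _).trans (hN m h i)
  zero_mem' := fun w => ⟨0, fun m hm => by simp at hm⟩
  smul_mem' := by
    intro c ψ hψ w
    obtain ⟨N, hN⟩ := hψ w
    refine ⟨N, fun m hm i => hN m (fun h => hm ?_) i⟩
    simp [h]

/-- The mode `ψ_m`, i.e. the coefficient of `x^{-m-1} = ∏_i x_i^{-m_i-1}` in `ψ(x)`. -/
def mode (ψ : Series n (Module.End ℂ W)) (m : Fin n → ℤ) : Module.End ℂ W :=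
  ψ (fun i => -m i - 1)

/-- Mutual locality: `(x - y)^k ψ(x) φ(y) = (x - y)^k φ(y) ψ(x)` for some `k ∈ ℕ`. -/
def MutuallyLocal (ψ φ : Series n (Module.End ℂ W)) : Prop :=
  ∃ k : ℕ, mulSeries (subPowConst n k) (fun a b => ψ a * φ b) =
    mulSeries (subPowConst n k) (fun a b => φ b * ψ a)

/-- The product `ψ(x) φ(y)`, as the map `w ↦ ψ(x) φ(y) w`. -/
def opProd (ψ φ : Series n (Module.End ℂ W)) : W → Series₂ n W :=
  fun w a b => ψ a (φ b w)

/-- `(x - y)^k f(x, y) ∈ Hom(W, W((x, y)))`; series with coefficients in `End W` are given through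
their values `w ↦ f(x, y) w`. The space `R(W, x, y)` consists of the `f` for which such a `k ∈ ℕ`
exists. -/
def ClearsPoles (k : ℕ) (f : W → Series₂ n W) : Prop :=
  ∀ w, IsLaurent₂ (mulSeries (subPowConst n k) (f w))

/-- The map `ι_{α,x,y}` on `R(W, x, y)`:
`ι_α(f(x, y)) w = ι_α((x - y)^{-k}) ((x - y)^k f(x, y) w)`, where `k ∈ ℕ` is such that
`(x - y)^k f(x, y) ∈ Hom(W, W((x, y)))` (we take the least one; the result does not depend on the
choice). -/
def iota (α : Fin n → ZMod 2) (f : W → Series₂ n W) : W → Series₂ n W :=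
  fun w =>
    let k : ℕ := sInf {k : ℕ | ClearsPoles k f}
    mulSeries (iotaPow α (fun _ => -(k : ℤ))) (mulSeries (subPowConst n k) (f w))

/-- The coefficient of `x^a y^b z^c` in
`∑_α (-1)^{|α|} ι_{α,x,y}(z⁻¹ δ((x - y)/z) ψ(x) φ(y)) w`. Since
`z⁻¹ δ((x - y)/z) = ∑_{m ∈ ℤⁿ} (x - y)^m z^{-m-1}`, the power `z^c` comes with
`(x - y)^{-c-1}`. -/
def jacobiProducts (ψ φ : Series n (Module.End ℂ W)) (w : W) (a b c : Fin n → ℤ) : W :=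
  ∑ α : Fin n → ZMod 2, (-1 : ℂ) ^ (hammingNorm α) •
    iota α (fun w' => mulSeries (subPow (fun i => -c i - 1)) (opProd ψ φ w')) w a b

/-- The coefficient of `x^a y^b z^c` in `y⁻¹ δ((x - z)/y) G(y, z)`, where `G b c` is the
coefficient of `y^b z^c` in `G(y, z)`. Since
`y⁻¹ δ((x - z)/y) = ∑_{m ∈ ℤⁿ} (x - z)^m y^{-m-1}`, the coefficient of `x^a y^{b'} z^{c'}` in the
delta function is the coefficient of `x^a z^{c'}` in `(x - z)^{-b'-1}`. -/
def jacobiIterate (G : Series₂ n W) (a b c : Fin n → ℤ) : W :=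
  ∑ᶠ p : (Fin n → ℤ) × (Fin n → ℤ),
    subPow (fun i => -p.1 i - 1) a p.2 • G (b - p.1) (c - p.2)

end Operators

/-- A `G_n`-vertex algebra structure on the complex vector space `V`: the vertex operator map
`Y(·, x)` and the vacuum vector, subject to the truncation condition, the vacuum and creation
properties, weak commutativity and the Jacobi identity. -/
@[ext]
structure GnVertexAlgebra (n : ℕ) (V : Type*) [AddCommGroup V] [Module ℂ V] where
  /-- `v ↦ Y(v, x)` -/
  Y : V →ₗ[ℂ] Series n (Module.End ℂ V)
  /-- the vacuum vector `𝟏` -/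
  vac : V
  /-- `Y(u, x) v ∈ V((x))` -/
  truncation : ∀ u, Y u ∈ VO n V
  /-- `Y(𝟏, x) = 1` -/
  vacuum : Y vac = Pi.single 0 1
  /-- `Y(v, x) 𝟏 ∈ V[[x]]` -/
  creation : ∀ v, IsPower (fun m => Y v m vac)
  /-- `lim_{x → 0} Y(v, x) 𝟏 = v` -/
  creation_limit : ∀ v, Y v 0 vac = v
  /-- weak commutativity -/
  locality : ∀ u v, MutuallyLocal (Y u) (Y v)
  /-- the Jacobi identity, applied to an arbitrary vector `w`, coefficient by coefficient;
  the coefficient of `y^b z^c` in `Y(Y(u, z) v, y) w` is `Y(u_{(c)} v)_{(b)} w`, where `(c)`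
  denotes the coefficient of `z^c` -/
  jacobi : ∀ u v w a b c,
    jacobiIterate (fun b' c' => Y (Y u c' v) b' w) a b c = jacobiProducts (Y u) (Y v) w a b c

end

end GnVertex

open GnVertex

/-! The proof is a state-field correspondence. Let `S` be the set of given operators and `fieldSpace
d one S` the space of vertex operators that are covariant under the `d i`, create a vector from
`one`, and are local with all of `S`. Evaluation `ψ ↦ ψ 0 one` is a bijection from this space onto
the whole vector space (`stateMap_bijective`), and its inverse is the required vertex operator map.

Injectivity is Goddard's argument (`eq_zero_of_mem_fieldSpace`): covariance and `d i one = 0` make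
`ψ(x) one` depend only on its constant term, and locality with the generators carries its vanishing
to every vector. Surjectivity comes from products. The coefficients of `Y(ψ, z)φ` are defined as the
residue in `x` of the right side of the Jacobi identity (`IsProduct`). They are again covariant
(`IsProduct.isCovariant`), creative (`IsProduct.creation`) and local with whatever is local with
both factors (`IsProduct.mutuallyLocal`, Dong's lemma). Generation from `one` then reaches every
vector, and a second use of generation gives locality of all pairs.

The Jacobi identity holds for any mutually local pair (`jacobiIterate_jacobiSum`): as series in `x,
y, z` both sides are invariant under replacing multiplication by `x_i` with multiplication by `y_i +
z_i`, both are truncated in `z`, and they have the same residue in `x`; this determines them.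
Conversely its residue forces `Y(u_c v)` to be the product, which gives uniqueness.

The technical engine is `act_xSubYPow_injective`: powers of `x - y` can be cancelled among series
bounded below in the direction of a fixed expansion. Identities between expansions are therefore
checked after clearing denominators. -/

namespace GnVertex

noncomputable section

/-! ### Laurent polynomials acting on formal series, and cancellation. -/

section Act

variable {G H M M' ι : Type*} [AddCommGroup G] [AddCommGroup H]
  [AddCommGroup M] [Module ℂ M] [AddCommGroup M'] [Module ℂ M']

/-- Translation of functions on `G`, i.e. multiplication of formal series by a monomial. -/
def shift (G M : Type*) [AddCommGroup G] [AddCommGroup M] [Module ℂ M] :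
    Multiplicative G →* Module.End ℂ (G → M) where
  toFun g :=
    { toFun := fun f h => f (h - g.toAdd)
      map_add' := fun _ _ => rfl
      map_smul' := fun _ _ => rfl }
  map_one' := by
    ext f h
    simp
  map_mul' g g' := by
    refine LinearMap.ext fun f => funext fun h => ?_
    change f (h - (g.toAdd + g'.toAdd)) = f (h - g.toAdd - g'.toAdd)
    rw [sub_sub]

/-- Multiplication of formal series with exponents in `G` by Laurent polynomials. -/
def act : AddMonoidAlgebra ℂ G →ₐ[ℂ] Module.End ℂ (G → M) :=
  AddMonoidAlgebra.lift ℂ _ G (shift G M)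

lemma act_single (g : G) (c : ℂ) (f : G → M) (h : G) :
    act (AddMonoidAlgebra.single g c) f h = c • f (h - g) := by
  simp [act, AddMonoidAlgebra.lift_single, shift]

lemma act_mul (p q : AddMonoidAlgebra ℂ G) (f : G → M) : act (p * q) f = act p (act q f) := by
  rw [map_mul]; rfl

lemma act_add (p q : AddMonoidAlgebra ℂ G) (f : G → M) : act (p + q) f = act p f + act q f := by
  rw [map_add]; rfl

lemma act_sub (p q : AddMonoidAlgebra ℂ G) (f : G → M) : act (p - q) f = act p f - act q f := by
  rw [map_sub]; rfl

lemma act_comm (p q : AddMonoidAlgebra ℂ G) (f : G → M) :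
    act p (act q f) = act q (act p f) := by
  rw [← act_mul, mul_comm, act_mul]

lemma act_comp_linear (L : M →ₗ[ℂ] M') (p : AddMonoidAlgebra ℂ G) (f : G → M) :
    act p (fun h => L (f h)) = fun h => L (act p f h) := by
  induction p using AddMonoidAlgebra.induction_linear with
  | zero => ext h; simp
  | add p q hp hq => ext h; simp [hp, hq]
  | single g c => ext h; simp [act_single]

/-- Restricting a series to a coset of the image of `j` commutes with multiplication. This serves
both for freezing one set of variables and for exchanging `x` and `y`. -/
lemma act_slice (j : H →+ G) (g₀ : G) (p : AddMonoidAlgebra ℂ H) (f : G → M) :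
    act p (fun h => f (g₀ + j h)) =
      fun h => act (AddMonoidAlgebra.mapDomainRingHom ℂ j p) f (g₀ + j h) := by
  induction p using AddMonoidAlgebra.induction_linear with
  | zero => ext h; simp
  | add p q hp hq => 
    funext h
    rw [act_add, hp, hq, map_add (AddMonoidAlgebra.mapDomainRingHom ℂ j), act_add]
    rfl
  | single g c => ext h; simp [act_single, add_sub_assoc]

/-- The series whose exponents are bounded below along each of the functionals `ℓ i`. -/
def bddBelow (M : Type*) [AddCommGroup M] [Module ℂ M] (ℓ : ι → G →+ ℤ) :
    Submodule ℂ (G → M) where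
  carrier := {f | ∃ N : ℤ, ∀ g, f g ≠ 0 → ∀ i, N ≤ ℓ i g}
  add_mem' := by
    rintro f f' ⟨N, hN⟩ ⟨N', hN'⟩
    refine ⟨min N N', fun g hg i => ?_⟩
    by_cases h : f g = 0
    · exact (min_le_right _ _).trans (hN' g (fun h' => hg (by simp [h, h'])) i)
    · exact (min_le_left _ _).trans (hN g h i)
  zero_mem' := ⟨0, fun g hg => by simp at hg⟩
  smul_mem' := by
    rintro c f ⟨N, hN⟩
    exact ⟨N, fun g hg i => hN g (fun h => hg (by simp [h])) i⟩

lemma exists_int_le [Finite ι] (v : ι → ℤ) : ∃ N : ℤ, ∀ i, N ≤ v i := by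
  obtain ⟨N, hN⟩ := (Set.finite_range v).bddBelow
  exact ⟨N, fun i => hN ⟨i, rfl⟩⟩

lemma act_mem_bddBelow [Finite ι] {ℓ : ι → G →+ ℤ} {f : G → M} (hf : f ∈ bddBelow M ℓ)
    (p : AddMonoidAlgebra ℂ G) : act p f ∈ bddBelow M ℓ := by
  induction p using AddMonoidAlgebra.induction_linear with
  | zero => simp
  | add p q hp hq => rw [act_add]; exact add_mem hp hq
  | single g c =>
    obtain ⟨N, hN⟩ := hf
    obtain ⟨N', hN'⟩ := exists_int_le fun i => ℓ i g
    refine ⟨N + N', fun h hh i => ?_⟩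
    have h1 := hN (h - g) (fun h0 => hh (by rw [act_single, h0, smul_zero])) i
    have h2 := hN' i
    rw [map_sub] at h1
    linarith

lemma eq_zero_of_step {ℓ : ι → G →+ ℤ} {f : G → M} (hf : f ∈ bddBelow M ℓ) (w : G) (i : ι)
    (hw : 0 < ℓ i w) (h : ∀ g, f (g - w) = 0 → f g = 0) : f = 0 := by
  obtain ⟨N, hN⟩ := hf
  have key : ∀ r : ℕ, ∀ g, f (g - r • w) = 0 → f g = 0 := by
    intro r
    induction r with
    | zero => intro g hg; simpa using hg
    | succ r ih =>
      intro g hg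
      refine ih g (h _ ?_)
      rwa [sub_sub, ← succ_nsmul]
  funext g
  -- Each subtraction of `w` lowers `ℓ i` by at least one, so this many steps lead strictly below
  -- the bound `N`.
  refine key (ℓ i g - N).toNat.succ g ?_
  by_contra hne
  have := hN _ hne i
  rw [map_sub, map_nsmul, nsmul_eq_mul] at this
  have h2 : ℓ i g - N < ((ℓ i g - N).toNat.succ : ℤ) := by
    push_cast
    have := Int.self_le_toNat (ℓ i g - N)
    omega
  nlinarith

/-- A series killed by a difference of two monomials is periodic under `u - v`. As `ℓ i` is nonzero
on that period, a nonzero value would recur arbitrarily far down. -/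
lemma eq_zero_of_act_sub_eq_zero {ℓ : ι → G →+ ℤ} {f : G → M} (hf : f ∈ bddBelow M ℓ) (u v : G)
    (i : ι) (huv : ℓ i u ≠ ℓ i v)
    (h : act (AddMonoidAlgebra.single u 1 - AddMonoidAlgebra.single v 1) f = 0) : f = 0 := by
  have h' : ∀ g, f (g - u) = f (g - v) := fun g => by
    have := congrFun h g
    rw [act_sub] at this
    simpa [act_single, sub_eq_zero] using this
  rcases lt_or_gt_of_ne huv with hlt | hlt
  · refine eq_zero_of_step hf (v - u) i (by rw [map_sub]; omega) fun g hg => ?_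
    have := h' (g + u)
    rw [add_sub_cancel_right] at this
    rw [this, ← hg]
    congr 1; abel
  · refine eq_zero_of_step hf (u - v) i (by rw [map_sub]; omega) fun g hg => ?_
    have := h' (g + v)
    rw [add_sub_cancel_right] at this
    rw [← this, ← hg]
    congr 1; abel

/-- The product of a series of scalars and a series, where each coefficient is a finite sum. -/
def conv (c : G → ℂ) (f : G → M) : G → M := fun g => ∑ᶠ p, c p • f (g - p)

/-- Each coefficient of the product of `c` and `f` is a finite sum. -/
def Summable (c : G → ℂ) (f : G → M) : Prop := ∀ g, {p | c p ≠ 0 ∧ f (g - p) ≠ 0}.Finite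

lemma Summable.support_finite {c : G → ℂ} {f : G → M} (h : Summable c f) (g : G) :
    (Function.support fun p => c p • f (g - p)).Finite := by
  refine (h g).subset fun p hp => ?_
  constructor
  · rintro h0; simp [h0] at hp
  · rintro h0; simp [h0] at hp

lemma act_conv {c c' : G → ℂ} {f : G → M} (u v : G) (h : Summable c f)
    (hc : ∀ g, c' g = c (g - u) - c (g - v)) :
    conv c' f = act (AddMonoidAlgebra.single u 1 - AddMonoidAlgebra.single v 1) (conv c f) := by
  have key : ∀ u g, (fun p => c (p - u) • f (g - p)) =
      (fun p => c p • f (g - u - p)) ∘ (Equiv.subRight u) := fun u g => by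
    funext p; simp
  funext g
  simp only [act_sub, Pi.sub_apply, act_single, one_smul, conv, hc, sub_smul]
  rw [finsum_sub_distrib]
  · congr 1
    · rw [key]
      exact finsum_comp_equiv (f := fun p => c p • f (g - u - p)) (Equiv.subRight u)
    · rw [key]
      exact finsum_comp_equiv (f := fun p => c p • f (g - v - p)) (Equiv.subRight v)
  all_goals
    rw [key]
    exact (h.support_finite _).preimage (Equiv.injective _).injOn

lemma conv_add {c : G → ℂ} {f f' : G → M} (h : Summable c f) (h' : Summable c f') :
    conv c (f + f') = conv c f + conv c f' := by
  funext g
  simp only [conv, Pi.add_apply, smul_add]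
  exact finsum_add_distrib (h.support_finite g) (h'.support_finite g)

lemma conv_comp_linear (L : M →ₗ[ℂ] M') {c : G → ℂ} {f : G → M} (h : Summable c f) :
    conv c (fun g => L (f g)) = fun g => L (conv c f g) := by
  funext g
  simp only [conv]
  have := L.toAddMonoidHom.map_finsum (h.support_finite g)
  simpa using this.symm

end Act

/-! ### The expansions of `(x - y)^m` and multiplication by them. -/

section

lemma binomCoeff_succ (ε : ZMod 2) (m a b : ℤ) :
    binomCoeff ε (m + 1) a b = binomCoeff ε m (a - 1) b - binomCoeff ε m a (b - 1) := by
  have pascal : ∀ k : ℤ, 0 < k → (Ring.choose (m + 1) k.toNat : ℤ) =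
      Ring.choose m (k - 1).toNat + Ring.choose m k.toNat := fun k hk => by
    obtain ⟨j, rfl⟩ : ∃ j : ℕ, k = j + 1 := ⟨(k - 1).toNat, by omega⟩
    have h1 : ((j : ℤ) + 1).toNat = j + 1 := by omega
    have h2 : ((j : ℤ) + 1 - 1).toNat = j := by omega
    rw [h1, h2, Ring.choose_succ_succ]
  have sign : (-1 : ℂ) ^ b = -(-1 : ℂ) ^ (b - 1) := by
    rw [zpow_sub_one₀ (by norm_num)]; norm_num
  unfold binomCoeff
  by_cases hab : a + b = m + 1
  · rw [if_pos hab, if_pos (by omega : a - 1 + b = m), if_pos (by omega : a + (b - 1) = m)]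
    by_cases hε : ε = 0
    · simp only [if_pos hε]
      rcases lt_trichotomy b 0 with hb | rfl | hb
      · rw [if_neg (by omega), if_neg (by omega), if_neg (by omega)]; simp
      · simp
      · rw [if_pos (by omega), if_pos (by omega), if_pos (by omega), pascal b hb, sign]
        push_cast; ring
    · simp only [if_neg hε]
      rcases lt_trichotomy a 0 with ha | rfl | ha
      · rw [if_neg (by omega), if_neg (by omega), if_neg (by omega)]; simp
      · simp [sign]
      · rw [if_pos (by omega), if_pos (by omega), if_pos (by omega), pascal a ha, sign]
        push_cast; ring
  · rw [if_neg hab, if_neg (by omega), if_neg (by omega), sub_zero]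

lemma binomCoeff_zero (ε : ZMod 2) (a b : ℤ) :
    binomCoeff ε 0 a b = if a = 0 ∧ b = 0 then 1 else 0 := by
  unfold binomCoeff
  by_cases h : a = 0 ∧ b = 0
  · obtain ⟨rfl, rfl⟩ := h
    simp
  · rw [if_neg h]
    split_ifs with h1 h2 h3 h3
    · rw [Ring.choose_zero_pos ℤ (by omega)]; simp
    · rfl
    · rw [Ring.choose_zero_pos ℤ (by omega)]; simp
    · rfl
    · rfl

/-- For a nonnegative exponent the power is a polynomial, so both expansions agree: they satisfy the
same Pascal recursion from the same start. -/
lemma binomCoeff_natCast (ε ε' : ZMod 2) (m : ℕ) (a b : ℤ) :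
    binomCoeff ε m a b = binomCoeff ε' m a b := by
  induction m generalizing a b with
  | zero => simp only [Nat.cast_zero, binomCoeff_zero]
  | succ m ih => simp only [Nat.cast_succ, binomCoeff_succ, ih]

lemma add_eq_of_binomCoeff_ne_zero {ε : ZMod 2} {m a b : ℤ} (h : binomCoeff ε m a b ≠ 0) :
    a + b = m := by
  unfold binomCoeff at h
  by_contra h'
  simp [h'] at h

lemma nonneg_of_binomCoeff_ne_zero {ε : ZMod 2} {m a b : ℤ} (h : binomCoeff ε m a b ≠ 0) :
    0 ≤ if ε = 0 then b else a := by
  unfold binomCoeff at h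
  split_ifs at h ⊢ <;> first | assumption | exact absurd rfl h

lemma nonneg_of_binomCoeff_natCast_ne_zero {ε : ZMod 2} {m : ℕ} {a b : ℤ}
    (h : binomCoeff ε m a b ≠ 0) : 0 ≤ a ∧ 0 ≤ b := by
  have h0 := h
  have h1 := h
  rw [binomCoeff_natCast ε 0] at h0
  rw [binomCoeff_natCast ε 1] at h1
  exact ⟨by simpa using nonneg_of_binomCoeff_ne_zero h1,
    by simpa using nonneg_of_binomCoeff_ne_zero h0⟩

variable {n : ℕ} {M M' : Type*} [AddCommGroup M] [Module ℂ M] [AddCommGroup M'] [Module ℂ M']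

/-- The exponents of monomials in `n` variables. -/
abbrev Exp (n : ℕ) := Fin n → ℤ

lemma iotaPow_add_single (α : Fin n → ZMod 2) (m : Exp n) (i : Fin n) (a b : Exp n) :
    iotaPow α (m + Pi.single i 1) a b =
      iotaPow α m (a - Pi.single i 1) b - iotaPow α m a (b - Pi.single i 1) := by
  classical
  have key : ∀ m a b : Exp n, iotaPow α m a b =
      binomCoeff (α i) (m i) (a i) (b i) *
        ∏ j ∈ Finset.univ.erase i, binomCoeff (α j) (m j) (a j) (b j) := fun m a b =>
    (Finset.mul_prod_erase _ _ (Finset.mem_univ i)).symm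
  have h : ∀ m a b m' a' b' : Exp n, (∀ j ≠ i, m j = m' j ∧ a j = a' j ∧ b j = b' j) →
      ∏ j ∈ Finset.univ.erase i, binomCoeff (α j) (m j) (a j) (b j) =
      ∏ j ∈ Finset.univ.erase i, binomCoeff (α j) (m' j) (a' j) (b' j) := by
    intro m a b m' a' b' hj
    refine Finset.prod_congr rfl fun j hji => ?_
    obtain ⟨h1, h2, h3⟩ := hj j (Finset.ne_of_mem_erase hji)
    rw [h1, h2, h3]
  rw [key, key m, key m, h (m + Pi.single i 1) a b m a b (by intro j hj; simp [hj]),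
    h m (a - Pi.single i 1) b m a b (by intro j hj; simp [hj]),
    h m a (b - Pi.single i 1) m a b (by intro j hj; simp [hj]), ← sub_mul]
  simp [binomCoeff_succ]

lemma iotaPow_zero (α : Fin n → ZMod 2) (a b : Exp n) :
    iotaPow α 0 a b = if a = 0 ∧ b = 0 then 1 else 0 := by
  unfold iotaPow
  simp only [Pi.zero_apply, binomCoeff_zero]
  split_ifs with h
  · obtain ⟨rfl, rfl⟩ := h; simp
  · have : ∃ i, ¬ (a i = 0 ∧ b i = 0) := by
      by_contra! h'
      exact h ⟨funext fun i => (h' i).1, funext fun i => (h' i).2⟩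
    obtain ⟨i, hi⟩ := this
    exact Finset.prod_eq_zero (Finset.mem_univ i) (if_neg hi)

lemma binomCoeff_ne_zero_of_iotaPow {α : Fin n → ZMod 2} {m a b : Exp n}
    (h : iotaPow α m a b ≠ 0) (i : Fin n) : binomCoeff (α i) (m i) (a i) (b i) ≠ 0 :=
  Finset.prod_ne_zero_iff.1 h i (Finset.mem_univ i)

/-- The exponent of `y_i` or of `x_i`, according to the direction of the expansion `ι_α`. -/
def expandDeg (α : Fin n → ZMod 2) (i : Fin n) : Exp n × Exp n →+ ℤ :=
  if α i = 0 then (Pi.evalAddMonoidHom _ i).comp (AddMonoidHom.snd _ _)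
  else (Pi.evalAddMonoidHom _ i).comp (AddMonoidHom.fst _ _)

lemma expandDeg_apply (α : Fin n → ZMod 2) (i : Fin n) (p : Exp n × Exp n) :
    expandDeg α i p = if α i = 0 then p.2 i else p.1 i := by
  unfold expandDeg
  split_ifs <;> rfl

/-- The constant directions `0` and `1` bound all the `y_i` and all the `x_i` respectively; together
they bound every direction `α`. -/
lemma isLaurent₂_iff (f : Series₂ n M) :
    IsLaurent₂ f ↔ Function.uncurry f ∈ bddBelow M (expandDeg 0) ∧
      Function.uncurry f ∈ bddBelow M (expandDeg 1) := by
  constructor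
  · rintro ⟨N, hN⟩
    exact ⟨⟨N, fun g hg i => by simpa [expandDeg_apply] using (hN g.1 g.2 hg i).2⟩,
      ⟨N, fun g hg i => by simpa [expandDeg_apply] using (hN g.1 g.2 hg i).1⟩⟩
  · rintro ⟨⟨N, hN⟩, ⟨N', hN'⟩⟩
    refine ⟨min N N', fun a b h i => ?_⟩
    have h1 := hN (a, b) h i
    have h2 := hN' (a, b) h i
    simp only [expandDeg_apply, Pi.zero_apply, Pi.one_apply, if_true, one_ne_zero, if_false]
      at h1 h2
    exact ⟨(min_le_right _ _).trans h2, (min_le_left _ _).trans h1⟩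

lemma IsLaurent₂.mem_bddBelow {f : Series₂ n M} (h : IsLaurent₂ f) (α : Fin n → ZMod 2) :
    Function.uncurry f ∈ bddBelow M (expandDeg α) := by
  obtain ⟨N, hN⟩ := h
  refine ⟨N, fun g hg i => ?_⟩
  rw [expandDeg_apply]
  split_ifs
  exacts [(hN _ _ hg i).2, (hN _ _ hg i).1]

/-- Multiplication by `ι_α((x - y)^m)`. -/
def iotaConv (α : Fin n → ZMod 2) (m : Exp n) (f : Exp n × Exp n → M) : Exp n × Exp n → M :=
  conv (Function.uncurry (iotaPow α m)) f

lemma finite_of_bounds (s : Set (Exp n × Exp n)) (lo hi : Exp n)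
    (h : ∀ p ∈ s, ∀ i, (lo i ≤ p.1 i ∧ p.1 i ≤ hi i) ∧ (lo i ≤ p.2 i ∧ p.2 i ≤ hi i)) :
    s.Finite :=
  ((Set.finite_Icc lo hi).prod (Set.finite_Icc lo hi)).subset fun p hp =>
    ⟨⟨fun i => (h p hp i).1.1, fun i => (h p hp i).1.2⟩,
      ⟨fun i => (h p hp i).2.1, fun i => (h p hp i).2.2⟩⟩

lemma summable_iotaPow {α : Fin n → ZMod 2} (m : Exp n) {f : Exp n × Exp n → M}
    (hf : f ∈ bddBelow M (expandDeg α)) : Summable (Function.uncurry (iotaPow α m)) f := by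
  obtain ⟨N, hN⟩ := hf
  intro g
  refine finite_of_bounds _ (fun i => -|m i| - |g.1 i - N| - |g.2 i - N|)
    (fun i => |m i| + |g.1 i - N| + |g.2 i - N|) fun p hp i => ?_
  have h := binomCoeff_ne_zero_of_iotaPow hp.1 i
  have h1 := add_eq_of_binomCoeff_ne_zero h
  have h2 := nonneg_of_binomCoeff_ne_zero h
  have h3 := hN _ hp.2 i
  rw [expandDeg_apply] at h3
  simp only [Prod.fst_sub, Prod.snd_sub, Pi.sub_apply] at h3
  have a1 := le_abs_self (m i)
  have a2 := neg_abs_le (m i)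
  have b1 := le_abs_self (g.1 i - N)
  have b2 := abs_nonneg (g.1 i - N)
  have c1 := le_abs_self (g.2 i - N)
  have c2 := abs_nonneg (g.2 i - N)
  split_ifs at h2 h3 <;> refine ⟨⟨?_, ?_⟩, ?_, ?_⟩ <;> linarith

omit [Module ℂ M] in
lemma summable_iotaPow_of_nonneg {α : Fin n → ZMod 2} {m : Exp n} (hm : 0 ≤ m)
    (f : Exp n × Exp n → M) : Summable (Function.uncurry (iotaPow α m)) f := by
  intro g
  refine finite_of_bounds _ 0 m fun p hp i => ?_
  have h := binomCoeff_ne_zero_of_iotaPow hp.1 i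
  have h1 := add_eq_of_binomCoeff_ne_zero h
  rw [← Int.toNat_of_nonneg (hm i)] at h
  have h2 := nonneg_of_binomCoeff_natCast_ne_zero h
  simp only [Pi.zero_apply]
  omega

lemma iotaConv_mem {α : Fin n → ZMod 2} (m : Exp n) {f : Exp n × Exp n → M}
    (hf : f ∈ bddBelow M (expandDeg α)) : iotaConv α m f ∈ bddBelow M (expandDeg α) := by
  obtain ⟨N, hN⟩ := hf
  refine ⟨N, fun g hg i => ?_⟩
  obtain ⟨p, hp⟩ : ∃ p : Exp n × Exp n,
      Function.uncurry (iotaPow α m) p • f (g - p) ≠ 0 := by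
    by_contra! h
    exact hg (finsum_eq_zero_of_forall_eq_zero h)
  have h1 : iotaPow α m p.1 p.2 ≠ 0 := fun h => hp (by simp [Function.uncurry_def, h])
  have h2 := nonneg_of_binomCoeff_ne_zero (binomCoeff_ne_zero_of_iotaPow h1 i)
  have h3 := hN (g - p) (fun h => hp (by rw [h, smul_zero])) i
  rw [map_sub] at h3
  rw [← Prod.mk.eta (p := p)] at h3
  rw [← expandDeg_apply] at h2
  linarith

lemma iotaConv_zero (α : Fin n → ZMod 2) (f : Exp n × Exp n → M) : iotaConv α 0 f = f := by
  funext g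
  unfold iotaConv conv
  rw [finsum_eq_single _ 0]
  · simp [Function.uncurry_def, iotaPow_zero]
  · intro p hp
    have : ¬ (p.1 = 0 ∧ p.2 = 0) := fun h => hp (Prod.ext h.1 h.2)
    simp [Function.uncurry_def, iotaPow_zero, this]

/-- The Laurent polynomial `x_i - y_i`. -/
def xSubY (i : Fin n) : AddMonoidAlgebra ℂ (Exp n × Exp n) :=
  AddMonoidAlgebra.single (Pi.single i 1, 0) 1 - AddMonoidAlgebra.single (0, Pi.single i 1) 1

/-- The Laurent polynomial `∏_i (x_i - y_i)^{r_i}`. -/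
def xSubYPow (r : Fin n → ℕ) : AddMonoidAlgebra ℂ (Exp n × Exp n) := ∏ i, xSubY i ^ r i

lemma act_xSubY_apply (i : Fin n) (f : Exp n × Exp n → M) (a b : Exp n) :
    act (xSubY i) f (a, b) = f (a - Pi.single i 1, b) - f (a, b - Pi.single i 1) := by
  simp [xSubY, act_single]

lemma iotaConv_add_single {α : Fin n → ZMod 2} {m : Exp n} {f : Exp n × Exp n → M}
    (h : Summable (Function.uncurry (iotaPow α m)) f) (i : Fin n) :
    iotaConv α (m + Pi.single i 1) f = act (xSubY i) (iotaConv α m f) := by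
  refine act_conv _ _ h fun g => ?_
  simp [Function.uncurry_def, iotaPow_add_single]

/-- Summability is needed at all larger exponents because the factors `x_i - y_i` are split off one
at a time. -/
lemma iotaConv_add {α : Fin n → ZMod 2} {m : Exp n} {f : Exp n × Exp n → M}
    (h : ∀ m', m ≤ m' → Summable (Function.uncurry (iotaPow α m')) f) (r : Fin n → ℕ) :
    iotaConv α (fun i => m i + r i) f = act (xSubYPow r) (iotaConv α m f) := by
  classical
  have h1 : ∀ (i : Fin n) (r : ℕ) (m' : Exp n), m ≤ m' →
      iotaConv α (m' + r • Pi.single i 1) f = act (xSubY i ^ r) (iotaConv α m' f) := by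
    intro i r m' hm'
    induction r with
    | zero => simp
    | succ r ih =>
      rw [succ_nsmul, ← add_assoc, iotaConv_add_single, ih, ← act_mul, pow_succ']
      refine h _ (hm'.trans (le_add_of_nonneg_right (nsmul_nonneg ?_ _)))
      exact Pi.single_nonneg.2 zero_le_one
  have h2 : ∀ s : Finset (Fin n), iotaConv α (m + ∑ i ∈ s, r i • Pi.single i 1) f =
      act (∏ i ∈ s, xSubY i ^ r i) (iotaConv α m f) := by
    intro s
    induction s using Finset.induction_on with
    | empty => simp
    | insert i s hi ih =>
      rw [Finset.sum_insert hi, Finset.prod_insert hi, act_mul, ← ih, ← h1, add_assoc,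
        add_comm (r i • _)]
      exact le_add_of_nonneg_right (Finset.sum_nonneg fun j _ =>
        nsmul_nonneg (Pi.single_nonneg.2 zero_le_one) _)
  rw [xSubYPow, ← h2]
  congr 1
  funext j
  simp [Finset.sum_apply, Pi.single_apply]

lemma iotaConv_natCast (α : Fin n → ZMod 2) (r : Fin n → ℕ) (f : Exp n × Exp n → M) :
    iotaConv α (fun i => (r i : ℤ)) f = act (xSubYPow r) f := by
  have := iotaConv_add (α := α) (m := 0) (f := f)
    (fun m' hm' => summable_iotaPow_of_nonneg hm' f) r
  simpa [iotaConv_zero] using this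

lemma xSubYPow_add (r s : Fin n → ℕ) :
    (xSubYPow (r + s) : AddMonoidAlgebra ℂ (Exp n × Exp n)) = xSubYPow r * xSubYPow s := by
  simp [xSubYPow, pow_add, Finset.prod_mul_distrib]

/-- Only delta-like series, unbounded in both `x_i` and `y_i`, are killed by `x_i - y_i`. The
monomials `x_i` and `y_i` have different degree along `expandDeg α i`. -/
lemma eq_zero_of_act_xSubY {α : Fin n → ZMod 2} {f : Exp n × Exp n → M}
    (hf : f ∈ bddBelow M (expandDeg α)) (i : Fin n) (h : act (xSubY i) f = 0) : f = 0 := by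
  refine eq_zero_of_act_sub_eq_zero hf _ _ i ?_ h
  rw [expandDeg_apply, expandDeg_apply]
  split_ifs <;> simp

lemma eq_zero_of_act_xSubYPow {α : Fin n → ZMod 2} {f : Exp n × Exp n → M}
    (hf : f ∈ bddBelow M (expandDeg α)) (r : Fin n → ℕ) (h : act (xSubYPow r) f = 0) :
    f = 0 := by
  classical
  have h1 : ∀ (i : Fin n) (r : ℕ) (f : Exp n × Exp n → M), f ∈ bddBelow M (expandDeg α) →
      act (xSubY i ^ r) f = 0 → f = 0 := by
    intro i r
    induction r with
    | zero => intro f _ h; simpa using h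
    | succ r ih =>
      intro f hf h
      rw [pow_succ, act_mul] at h
      exact eq_zero_of_act_xSubY hf i (ih _ (act_mem_bddBelow hf _) h)
  have h2 : ∀ (s : Finset (Fin n)) (f : Exp n × Exp n → M), f ∈ bddBelow M (expandDeg α) →
      act (∏ i ∈ s, xSubY i ^ r i) f = 0 → f = 0 := by
    intro s
    induction s using Finset.induction_on with
    | empty => intro f _ h; simpa using h
    | insert i s hi ih =>
      intro f hf h
      rw [Finset.prod_insert hi, mul_comm, act_mul] at h
      refine h1 i (r i) f hf (ih _ (act_mem_bddBelow hf _) h)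
  exact h2 _ f hf h

lemma act_xSubYPow_injective {α : Fin n → ZMod 2} {f f' : Exp n × Exp n → M}
    (hf : f ∈ bddBelow M (expandDeg α)) (hf' : f' ∈ bddBelow M (expandDeg α)) (r : Fin n → ℕ)
    (h : act (xSubYPow r) f = act (xSubYPow r) f') : f = f' :=
  sub_eq_zero.1 (eq_zero_of_act_xSubYPow (sub_mem hf hf') r (by rw [map_sub, h, sub_self]))

lemma act_xSubYPow_iotaConv {α : Fin n → ZMod 2} {m : Exp n} {f : Exp n × Exp n → M}
    (hf : f ∈ bddBelow M (expandDeg α)) (r s : Fin n → ℕ) (hm : ∀ i, m i + s i = r i) :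
    act (xSubYPow s) (iotaConv α m f) = act (xSubYPow r) f := by
  rw [← iotaConv_add fun m' _ => summable_iotaPow m' hf, ← iotaConv_natCast α]
  congr 1
  exact funext hm

/-- With `m = r - s`, this identifies an expansion by its cleared form. It is the tool for comparing
different choices of denominators. -/
lemma eq_iotaConv {α : Fin n → ZMod 2} {m : Exp n} {f h : Exp n × Exp n → M}
    (hf : f ∈ bddBelow M (expandDeg α)) (hh : h ∈ bddBelow M (expandDeg α)) (r s : Fin n → ℕ)
    (hm : ∀ i, m i + s i = r i) (heq : act (xSubYPow s) h = act (xSubYPow r) f) :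
    h = iotaConv α m f :=
  act_xSubYPow_injective hh (iotaConv_mem m hf) s
    (heq.trans (act_xSubYPow_iotaConv hf r s hm).symm)

end

/-! ### The alternating sum of expansions and the delta-function identity. -/

section

variable {n : ℕ} {M M' : Type*} [AddCommGroup M] [Module ℂ M] [AddCommGroup M'] [Module ℂ M']

lemma bounds_of_iotaConv_ne_zero {α : Fin n → ZMod 2} {m : Exp n} {F : Exp n × Exp n → M} {N : ℤ}
    (hN : ∀ g, F g ≠ 0 → ∀ i, N ≤ g.1 i ∧ N ≤ g.2 i) {a b : Exp n}
    (h : iotaConv α m F (a, b) ≠ 0) (i : Fin n) :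
    (N ≤ if α i = 0 then b i else a i) ∧ m i + 2 * N ≤ a i + b i := by
  obtain ⟨p, hp⟩ : ∃ p : Exp n × Exp n,
      Function.uncurry (iotaPow α m) p • F ((a, b) - p) ≠ 0 := by
    by_contra! h'
    exact h (finsum_eq_zero_of_forall_eq_zero h')
  have h1 : iotaPow α m p.1 p.2 ≠ 0 := fun h => hp (by simp [Function.uncurry_def, h])
  have h2 := binomCoeff_ne_zero_of_iotaPow h1 i
  have h3 := nonneg_of_binomCoeff_ne_zero h2
  have h4 := add_eq_of_binomCoeff_ne_zero h2
  have h5 := hN ((a, b) - p) (fun h => hp (by rw [h, smul_zero])) i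
  simp only [Prod.fst_sub, Prod.snd_sub, Pi.sub_apply] at h5
  split_ifs at h3 ⊢ <;> constructor <;> linarith

/-- `∑_α (-1)^{|α|} ι_α((x - y)^{-c-1-k}) F(x, y)`. -/
def jacobiSum (k : ℕ) (F : Exp n × Exp n → M) (c : Exp n) : Exp n × Exp n → M :=
  ∑ α : Fin n → ZMod 2, (-1 : ℂ) ^ (hammingNorm α) • iotaConv α (fun i => -c i - 1 - k) F

/-- `F ∈ M((x, y))`. -/
def laurent₂ (n : ℕ) (M : Type*) [AddCommGroup M] [Module ℂ M] :
    Submodule ℂ (Exp n × Exp n → M) :=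
  bddBelow M (expandDeg 0) ⊓ bddBelow M (expandDeg 1)

lemma exists_bound_of_mem_laurent₂ {F : Exp n × Exp n → M} (hF : F ∈ laurent₂ n M) :
    ∃ N : ℤ, ∀ g, F g ≠ 0 → ∀ i, N ≤ g.1 i ∧ N ≤ g.2 i := by
  obtain ⟨N, hN⟩ := (isLaurent₂_iff (Function.curry F)).2 hF
  exact ⟨N, fun g => hN g.1 g.2⟩

lemma mem_bddBelow_of_mem_laurent₂ {F : Exp n × Exp n → M} (hF : F ∈ laurent₂ n M)
    (α : Fin n → ZMod 2) : F ∈ bddBelow M (expandDeg α) :=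
  ((isLaurent₂_iff (Function.curry F)).2 hF).mem_bddBelow α

lemma act_mem_laurent₂ {F : Exp n × Exp n → M} (hF : F ∈ laurent₂ n M)
    (p : AddMonoidAlgebra ℂ (Exp n × Exp n)) : act p F ∈ laurent₂ n M :=
  ⟨act_mem_bddBelow hF.1 p, act_mem_bddBelow hF.2 p⟩

/-- Lowering `c i` raises the exponent of `x_i - y_i`: on the generating series in `z`,
multiplication by `z_i` and by `x_i - y_i` agree. -/
lemma jacobiSum_sub_single {F : Exp n × Exp n → M} (hF : F ∈ laurent₂ n M) (k : ℕ) (c : Exp n)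
    (i : Fin n) : jacobiSum k F (c - Pi.single i 1) = act (xSubY i) (jacobiSum k F c) := by
  simp only [jacobiSum, map_sum, map_smul]
  refine Finset.sum_congr rfl fun α _ => ?_
  rw [← iotaConv_add_single (summable_iotaPow _ (mem_bddBelow_of_mem_laurent₂ hF α))]
  congr 2
  funext j
  simp only [Pi.sub_apply, Pi.add_apply]
  ring

lemma neg_one_pow_hammingNorm (α : Fin n → ZMod 2) :
    (-1 : ℂ) ^ (hammingNorm α) = ∏ i, if α i = 0 then 1 else -1 := by
  classical
  unfold hammingNorm
  rw [← Finset.prod_const, Finset.prod_filter]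
  refine Finset.prod_congr rfl fun i _ => ?_
  split_ifs <;> simp_all

lemma jacobiSum_eq_zero (F : Exp n × Exp n → M) (k : ℕ) {c : Exp n} {i : Fin n}
    (hi : c i < -k) : jacobiSum k F c = 0 := by
  classical
  unfold jacobiSum
  have hne : ∀ e : ZMod 2, (if e + 1 = 0 then (1 : ℂ) else -1) = -(if e = 0 then 1 else -1) := by
    intro e
    have h2 : (1 : ZMod 2) + 1 = 0 := by decide
    have he : ∀ e : ZMod 2, e = 0 ∨ e = 1 := by decide
    rcases he e with rfl | rfl
    · rw [zero_add, if_neg one_ne_zero, if_pos rfl]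
    · rw [h2, if_pos rfl, if_neg one_ne_zero, neg_neg]
  have hflip : ∀ α : Fin n → ZMod 2, (-1 : ℂ) ^ (hammingNorm (α + Pi.single i 1)) =
      -(-1 : ℂ) ^ (hammingNorm α) := by
    intro α
    rw [neg_one_pow_hammingNorm, neg_one_pow_hammingNorm,
      ← Finset.mul_prod_erase _ _ (Finset.mem_univ i),
      ← Finset.mul_prod_erase _ (fun j => if α j = 0 then (1 : ℂ) else -1) (Finset.mem_univ i),
      ← neg_mul]
    congr 1
    · simpa using hne (α i)
    · refine Finset.prod_congr rfl fun j hj => ?_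
      simp [Finset.ne_of_mem_erase hj]
  have hiota : ∀ α : Fin n → ZMod 2, iotaConv (α + Pi.single i 1) (fun i => -c i - 1 - k) F =
      iotaConv α (fun i => -c i - 1 - k) F := by
    intro α
    unfold iotaConv
    congr 1
    funext p
    simp only [Function.uncurry_def, iotaPow]
    refine Finset.prod_congr rfl fun j _ => ?_
    by_cases hj : j = i
    · subst hj
      obtain ⟨m, hm⟩ : ∃ m : ℕ, -c j - 1 - k = m := ⟨(-c j - 1 - k).toNat, by omega⟩
      rw [hm]
      exact binomCoeff_natCast _ _ _ _ _
    · simp [hj]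
  -- Since `c i < -k`, the exponent of `x_i - y_i` is nonnegative and the expansion ignores `α i`.
  -- Flipping `α i` only changes the sign, so the terms cancel in pairs.
  refine Finset.sum_involution (fun α _ => α + Pi.single i 1) ?_ ?_ ?_ ?_
  · intro α _
    rw [hflip, hiota, neg_smul, add_neg_cancel]
  · intro α _ _ h
    have := congrFun h i
    simp at this
  · intro α _
    exact Finset.mem_univ _
  · intro α _
    rw [add_assoc, ← Pi.single_add]
    have : (1 : ZMod 2) + 1 = 0 := by decide
    simp [this]

lemma jacobiSum_comp_linear (L : M →ₗ[ℂ] M') {F : Exp n × Exp n → M} (hF : F ∈ laurent₂ n M)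
    (k : ℕ) (c : Exp n) (g : Exp n × Exp n) :
    jacobiSum k (fun g => L (F g)) c g = L (jacobiSum k F c g) := by
  simp only [jacobiSum, Finset.sum_apply, Pi.smul_apply, map_sum, map_smul]
  refine Finset.sum_congr rfl fun α _ => ?_
  rw [iotaConv, conv_comp_linear L (summable_iotaPow _ (mem_bddBelow_of_mem_laurent₂ hF α))]
  rfl

lemma jacobiSum_add {F F' : Exp n × Exp n → M} (hF : F ∈ laurent₂ n M) (hF' : F' ∈ laurent₂ n M)
    (k : ℕ) (c : Exp n) : jacobiSum k (F + F') c = jacobiSum k F c + jacobiSum k F' c := by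
  simp only [jacobiSum, ← Finset.sum_add_distrib, ← smul_add]
  refine Finset.sum_congr rfl fun α _ => ?_
  rw [iotaConv, conv_add (summable_iotaPow _ (mem_bddBelow_of_mem_laurent₂ hF α))
    (summable_iotaPow _ (mem_bddBelow_of_mem_laurent₂ hF' α))]
  rfl

lemma exists_bound_jacobiSum {F : Exp n × Exp n → M} (hF : F ∈ laurent₂ n M) (k : ℕ)
    (a c : Exp n) : ∃ N : ℤ, ∀ b, jacobiSum k F c (a, b) ≠ 0 → ∀ i, N ≤ b i := by
  obtain ⟨N, hN⟩ := exists_bound_of_mem_laurent₂ hF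
  obtain ⟨N', hN'⟩ := exists_int_le fun i => -c i - 1 - k + 2 * N - a i
  refine ⟨min N N', fun b hb i => ?_⟩
  have : ∃ α : Fin n → ZMod 2, iotaConv α (fun i => -c i - 1 - k) F (a, b) ≠ 0 := by
    by_contra! h
    simp [jacobiSum, Finset.sum_apply, h] at hb
  obtain ⟨α, hα⟩ := this
  exact (min_le_right _ _).trans
    ((hN' i).trans (by linarith [(bounds_of_iotaConv_ne_zero hN hα i).2]))

lemma exp_induction {P : Exp n → Prop} (a₀ : Exp n) (h0 : P a₀)
    (hsub : ∀ a i, P a → P (a - Pi.single i 1)) (hadd : ∀ a i, P a → P (a + Pi.single i 1))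
    (a : Exp n) : P a := by
  classical
  have key : ∀ (s : ℕ) (a : Exp n), ∑ i, (a i - a₀ i).natAbs = s → P a := by
    intro s
    induction s with
    | zero =>
      intro a ha
      have : a = a₀ := funext fun i => by
        have := (Finset.sum_eq_zero_iff.1 ha) i (Finset.mem_univ i)
        omega
      exact this ▸ h0
    | succ s ih =>
      intro a ha
      obtain ⟨i, -, hi⟩ := Finset.exists_ne_zero_of_sum_ne_zero (by omega :
        ∑ i, (a i - a₀ i).natAbs ≠ 0)
      have step : ∀ e : ℤ, (a i + e - a₀ i).natAbs + 1 = (a i - a₀ i).natAbs →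
          P (a + Pi.single i e) := by
        intro e he
        refine ih _ ?_
        rw [← Finset.add_sum_erase _ _ (Finset.mem_univ i)] at ha ⊢
        have : ∑ j ∈ Finset.univ.erase i, ((a + Pi.single i e : Exp n) j - a₀ j).natAbs =
            ∑ j ∈ Finset.univ.erase i, (a j - a₀ j).natAbs :=
          Finset.sum_congr rfl fun j hj => by simp [Finset.ne_of_mem_erase hj]
        rw [this]
        simp only [Pi.add_apply, Pi.single_eq_same]
        omega
      rcases lt_or_ge (a₀ i) (a i) with h | h
      · have := hadd _ i (step (-1) (by omega))
        rwa [add_assoc, ← Pi.single_add, neg_add_cancel, Pi.single_zero, add_zero] at this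
      · have := hsub _ i (step 1 (by omega))
        rwa [add_sub_cancel_right] at this
  exact key _ a rfl

/-- A series `K(x, y, z)`, truncated in `z`, with `(x_i - z_i) K = y_i K` for all `i` and with
vanishing residue in `x`, is zero. -/
lemma eq_zero_of_delta_relation {K : Exp n → Exp n → Exp n → M} {N : ℤ}
    (hN : ∀ a b c, K a b c ≠ 0 → ∀ i, N ≤ c i)
    (hrel : ∀ a b c i, K (a - Pi.single i 1) b c =
      K a (b - Pi.single i 1) c + K a b (c - Pi.single i 1))
    (hres : ∀ b c, K (-1) b c = 0) (a : Exp n) : ∀ b c, K a b c = 0 := by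
  refine exp_induction (P := fun a => ∀ b c, K a b c = 0) (-1) hres ?_ ?_ a
  · intro a i h b c
    rw [hrel, h, h, add_zero]
  · intro a i h
    let ℓ : Fin n → Exp n × Exp n →+ ℤ := fun i =>
      (Pi.evalAddMonoidHom _ i).comp (AddMonoidHom.snd _ _)
    have hℓ : ∀ i g, ℓ i g = g.2 i := fun _ _ => rfl
    have : (fun g : Exp n × Exp n => K (a + Pi.single i 1) g.1 g.2) = 0 := by
      -- With the slice at `a` zero, the relation gives `K (a + e_i) b c = -K (a + e_i) (b + e_i) (c
      -- - e_i)`. Iterating pushes the `z_i`-exponent below `N`.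
      refine eq_zero_of_step (ℓ := ℓ) ⟨N, fun g hg j => hN _ _ _ hg j⟩
        (-Pi.single i 1, Pi.single i 1) i (by simp [hℓ]) fun g hg => ?_
      have := hrel (a + Pi.single i 1) (g.1 + Pi.single i 1) g.2 i
      rw [add_sub_cancel_right, add_sub_cancel_right, h] at this
      simp only [Prod.fst_sub, Prod.snd_sub, sub_neg_eq_add] at hg
      rw [hg, add_zero] at this
      exact this.symm
    exact fun b c => congrFun this (b, c)

lemma jacobiIterate_support_finite {G : Series₂ n M} {N : ℤ}
    (hN : ∀ b c, G b c ≠ 0 → ∀ i, N ≤ c i) (a b c : Exp n) :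
    (Function.support fun p : Exp n × Exp n =>
      subPow (fun i => -p.1 i - 1) a p.2 • G (b - p.1) (c - p.2)).Finite := by
  refine finite_of_bounds _ (fun i => -|a i| - |c i - N| - 1) (fun i => |a i| + |c i - N| + 1)
    fun p hp i => ?_
  have hp1 : subPow (fun i => -p.1 i - 1) a p.2 ≠ 0 := fun h => hp (by simp [h])
  have hp2 : G (b - p.1) (c - p.2) ≠ 0 := fun h => hp (by simp [h])
  have h := binomCoeff_ne_zero_of_iotaPow hp1 i
  have h1 := add_eq_of_binomCoeff_ne_zero h
  have h2 := nonneg_of_binomCoeff_ne_zero h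
  have h3 := hN _ _ hp2 i
  simp only [Pi.zero_apply, if_true, Pi.sub_apply] at h2 h3
  have a1 := le_abs_self (a i)
  have a2 := neg_abs_le (a i)
  have b1 := le_abs_self (c i - N)
  have b2 := abs_nonneg (c i - N)
  refine ⟨⟨?_, ?_⟩, ?_, ?_⟩ <;> linarith

/-- The delta function `y⁻¹ δ((x - z)/y)` is killed by `x_i - z_i - y_i`; after reindexing, this is
Pascal's rule. -/
lemma jacobiIterate_sub_single {G : Series₂ n M} {N : ℤ}
    (hN : ∀ b c, G b c ≠ 0 → ∀ i, N ≤ c i) (a b c : Exp n) (i : Fin n) :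
    jacobiIterate G (a - Pi.single i 1) b c =
      jacobiIterate G a (b - Pi.single i 1) c + jacobiIterate G a b (c - Pi.single i 1) := by
  let T : Exp n → Exp n → Exp n → Exp n × Exp n → M := fun a b c p =>
    subPow (fun i => -p.1 i - 1) a p.2 • G (b - p.1) (c - p.2)
  have hT : ∀ p, T (a - Pi.single i 1) b c p =
      T a (b - Pi.single i 1) c (p - (Pi.single i 1, 0)) +
      T a b (c - Pi.single i 1) (p - (0, Pi.single i 1)) := by
    intro p
    have h1 : (fun j => -(p.1 - Pi.single i 1 : Exp n) j - 1) =
        (fun j => -p.1 j - 1) + (Pi.single i 1 : Exp n) := by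
      funext j
      simp only [Pi.sub_apply, Pi.add_apply]
      ring
    have h2 := iotaPow_add_single 0 (fun j => -p.1 j - 1) i a p.2
    simp only [T, subPow, Prod.fst_sub, Prod.snd_sub, sub_zero, sub_sub_sub_cancel_right]
    rw [h1, h2, sub_smul, sub_add_cancel]
  unfold jacobiIterate
  change ∑ᶠ p, T (a - Pi.single i 1) b c p = ∑ᶠ p, T a (b - Pi.single i 1) c p +
    ∑ᶠ p, T a b (c - Pi.single i 1) p
  simp only [hT]
  rw [finsum_add_distrib]
  · congr 1
    · exact finsum_comp_equiv (f := T a (b - Pi.single i 1) c) (Equiv.subRight _)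
    · exact finsum_comp_equiv (f := T a b (c - Pi.single i 1)) (Equiv.subRight _)
  · exact (jacobiIterate_support_finite hN a (b - Pi.single i 1) c).preimage
      (Equiv.subRight (Pi.single i 1, 0)).injective.injOn
  · exact (jacobiIterate_support_finite hN a b (c - Pi.single i 1)).preimage
      (Equiv.subRight (0, Pi.single i 1)).injective.injOn

lemma le_of_jacobiIterate_ne_zero {G : Series₂ n M} {N : ℤ}
    (hN : ∀ b c, G b c ≠ 0 → ∀ i, N ≤ c i) {a b c : Exp n} (h : jacobiIterate G a b c ≠ 0)
    (i : Fin n) : N ≤ c i := by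
  obtain ⟨p, hp⟩ : ∃ p : Exp n × Exp n,
      subPow (fun i => -p.1 i - 1) a p.2 • G (b - p.1) (c - p.2) ≠ 0 := by
    by_contra! h'
    exact h (finsum_eq_zero_of_forall_eq_zero h')
  have hp1 : subPow (fun i => -p.1 i - 1) a p.2 ≠ 0 := fun h => hp (by simp [h])
  have hp2 : G (b - p.1) (c - p.2) ≠ 0 := fun h => hp (by simp [h])
  have h1 := nonneg_of_binomCoeff_ne_zero (binomCoeff_ne_zero_of_iotaPow hp1 i)
  have h2 := hN _ _ hp2 i
  simp only [Pi.zero_apply, if_true, Pi.sub_apply] at h1 h2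
  linarith

lemma subPow_neg_one_left (m b : Exp n) :
    subPow m (-1) b = if b = 0 ∧ m = -1 then 1 else 0 := by
  have key : ∀ m b : ℤ, binomCoeff 0 m (-1) b ≠ 0 → b = 0 ∧ m = -1 := by
    intro m b h
    have h1 := add_eq_of_binomCoeff_ne_zero h
    have h2 : 0 ≤ b := by simpa using nonneg_of_binomCoeff_ne_zero h
    have h3 : b = 0 := by
      by_contra h0
      -- If `b > 0`, then `m = b - 1` is nonnegative and the power is a polynomial, which has no
      -- term of exponent `-1`.
      obtain ⟨j, hj⟩ : ∃ j : ℕ, m = j := ⟨m.toNat, by omega⟩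
      rw [hj] at h
      exact absurd (nonneg_of_binomCoeff_natCast_ne_zero h).1 (by norm_num)
    exact ⟨h3, by omega⟩
  split_ifs with h
  · obtain ⟨rfl, rfl⟩ := h
    simp [subPow, iotaPow, binomCoeff]
  · by_contra hne
    have := fun i => key _ _ (binomCoeff_ne_zero_of_iotaPow hne i)
    exact h ⟨funext fun i => (this i).1, funext fun i => (this i).2⟩

lemma jacobiIterate_neg_one (G : Series₂ n M) (b c : Exp n) :
    jacobiIterate G (-1) b c = G b c := by
  unfold jacobiIterate
  have h0 : (fun _ => -1 : Exp n) = -1 := rfl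
  rw [finsum_eq_single _ (0 : Exp n × Exp n)]
  · simp [subPow_neg_one_left, h0]
  · intro p hp
    rw [subPow_neg_one_left, if_neg, zero_smul]
    rintro ⟨h1, h2⟩
    refine hp (Prod.ext (funext fun i => ?_) h1)
    have := congrFun h2 i
    simp only [Pi.neg_apply, Pi.one_apply] at this
    simp only [Prod.fst_zero, Pi.zero_apply]
    omega

/-- The Jacobi identity for `F(x, y) ∈ M((x, y))`. -/
lemma jacobiIterate_jacobiSum {F : Exp n × Exp n → M} (hF : F ∈ laurent₂ n M) (k : ℕ)
    (a b c : Exp n) :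
    jacobiIterate (fun b c => jacobiSum k F c (-1, b)) a b c = jacobiSum k F c (a, b) := by
  have hJ : ∀ a b c, jacobiSum k F c (a, b) ≠ 0 → ∀ i, (-k : ℤ) ≤ c i := by
    intro a b c h i
    by_contra! hlt
    exact h (by rw [jacobiSum_eq_zero F k hlt]; rfl)
  have hG : ∀ b c, jacobiSum k F c (-1, b) ≠ 0 → ∀ i, (-k : ℤ) ≤ c i := hJ (-1)
  refine sub_eq_zero.1 (eq_zero_of_delta_relation (N := -k) (K := fun a b c =>
    jacobiIterate (fun b c => jacobiSum k F c (-1, b)) a b c - jacobiSum k F c (a, b))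
    ?_ ?_ ?_ a b c)
  · intro a b c h i
    by_contra! hlt
    refine h ?_
    rw [not_imp_comm.1 (hJ a b c) fun h => absurd (h i) (not_le.2 hlt),
      not_imp_comm.1 (fun h => le_of_jacobiIterate_ne_zero hG h)
        fun h => absurd (h i) (not_le.2 hlt), sub_zero]
  · intro a b c i
    rw [jacobiIterate_sub_single hG, jacobiSum_sub_single hF, act_xSubY_apply]
    abel
  · intro b c
    rw [jacobiIterate_neg_one, sub_self]

end

/-! ### Products of mutually local vertex operators. -/

section

variable {n : ℕ} {W M M' : Type*} [AddCommGroup W] [Module ℂ W] [AddCommGroup M] [Module ℂ M]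
  [AddCommGroup M'] [Module ℂ M']

/-- The coefficients of `ψ(x) φ(y) w`. -/
def prodAt (ψ φ : Series n (Module.End ℂ W)) (w : W) : Exp n × Exp n → W :=
  fun p => ψ p.1 (φ p.2 w)

/-- The coefficients of `φ(y) ψ(x) w`. -/
def revAt (ψ φ : Series n (Module.End ℂ W)) (w : W) : Exp n × Exp n → W :=
  fun p => φ p.2 (ψ p.1 w)

/-- Mutual locality with a given exponent, vector by vector. -/
def LocalAt (k : ℕ) (ψ φ : Series n (Module.End ℂ W)) : Prop :=
  ∀ w, act (xSubYPow fun _ => k) (prodAt ψ φ w) = act (xSubYPow fun _ => k) (revAt ψ φ w)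

lemma uncurry_mulSeries_subPowConst (k : ℕ) (f : Series₂ n M) :
    Function.uncurry (mulSeries (subPowConst n k) f) =
      act (xSubYPow fun _ => k) (Function.uncurry f) :=
  iotaConv_natCast 0 (fun _ => k) (Function.uncurry f)

lemma mutuallyLocal_iff (ψ φ : Series n (Module.End ℂ W)) :
    MutuallyLocal ψ φ ↔ ∃ k, LocalAt k ψ φ := by
  refine exists_congr fun k => ?_
  have h1 : ∀ (f : Exp n × Exp n → Module.End ℂ W) (w : W) (p : AddMonoidAlgebra ℂ _),
      act p (fun g => f g w) = fun g => act p f g w := fun f w p =>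
    act_comp_linear (LinearMap.applyₗ w) p f
  rw [← Function.uncurry_injective.eq_iff]
  rw [uncurry_mulSeries_subPowConst, uncurry_mulSeries_subPowConst]
  constructor
  · intro h w
    have h2 := h1 (Function.uncurry fun a b => ψ a * φ b) w (xSubYPow fun _ => k)
    have h3 := h1 (Function.uncurry fun a b => φ b * ψ a) w (xSubYPow fun _ => k)
    rw [h, ← h3] at h2
    exact h2
  · intro h
    funext g
    refine LinearMap.ext fun w => ?_
    have h2 := h1 (Function.uncurry fun a b => ψ a * φ b) w (xSubYPow fun _ => k)
    have h3 := h1 (Function.uncurry fun a b => φ b * ψ a) w (xSubYPow fun _ => k)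
    exact (congrFun h2 g).symm.trans ((congrFun (h w) g).trans (congrFun h3 g))

lemma LocalAt.mono {k l : ℕ} (hkl : k ≤ l) {ψ φ : Series n (Module.End ℂ W)}
    (h : LocalAt k ψ φ) : LocalAt l ψ φ := by
  intro w
  have : (fun _ => l : Fin n → ℕ) = (fun _ => l - k) + fun _ => k := by
    funext i
    simp only [Pi.add_apply]
    omega
  rw [this, xSubYPow_add, act_mul, act_mul, h w]

lemma prodAt_mem (ψ : Series n (Module.End ℂ W)) {φ : Series n (Module.End ℂ W)}
    (hφ : φ ∈ VO n W) (w : W) : prodAt ψ φ w ∈ bddBelow W (expandDeg 0) := by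
  obtain ⟨N, hN⟩ := hφ w
  refine ⟨N, fun g hg i => ?_⟩
  rw [expandDeg_apply, if_pos (by rfl)]
  exact hN g.2 (fun h => hg (by simp [prodAt, h])) i

lemma revAt_mem {ψ : Series n (Module.End ℂ W)} (φ : Series n (Module.End ℂ W))
    (hψ : ψ ∈ VO n W) (w : W) : revAt ψ φ w ∈ bddBelow W (expandDeg 1) := by
  obtain ⟨N, hN⟩ := hψ w
  refine ⟨N, fun g hg i => ?_⟩
  rw [expandDeg_apply, if_neg (by simp)]
  exact hN g.1 (fun h => hg (by simp [revAt, h])) i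

/-- The coefficients of `(x - y)^k ψ(x) φ(y) w`. -/
def clearAt (k : ℕ) (ψ φ : Series n (Module.End ℂ W)) (w : W) : Exp n × Exp n → W :=
  act (xSubYPow fun _ => k) (prodAt ψ φ w)

/-- The product `ψ(x)φ(y)w` is bounded below in `y`, the reversed one in `x`. Locality identifies
them after clearing, so both bounds hold. -/
lemma clearAt_mem {k : ℕ} {ψ φ : Series n (Module.End ℂ W)} (hψ : ψ ∈ VO n W) (hφ : φ ∈ VO n W)
    (h : LocalAt k ψ φ) (w : W) : clearAt k ψ φ w ∈ laurent₂ n W := by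
  refine ⟨act_mem_bddBelow (prodAt_mem ψ hφ w) _, ?_⟩
  rw [SetLike.mem_coe, clearAt, h w]
  exact act_mem_bddBelow (revAt_mem φ hψ w) _

lemma act_iotaConv_clearAt {k : ℕ} {ψ φ : Series n (Module.End ℂ W)} (hψ : ψ ∈ VO n W)
    (hφ : φ ∈ VO n W) (h : LocalAt k ψ φ) (w : W) (α : Fin n → ZMod 2) {m : Exp n}
    (r s : Fin n → ℕ) (hrs : ∀ i, m i + s i = r i) :
    act (xSubYPow s) (iotaConv α m (clearAt k ψ φ w)) =
      act (xSubYPow (r + fun _ => k)) (prodAt ψ φ w) := by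
  rw [act_xSubYPow_iotaConv (mem_bddBelow_of_mem_laurent₂ (clearAt_mem hψ hφ h w) α) r s hrs,
    clearAt, xSubYPow_add, act_mul]

/-- In the direction `0` the product itself is already bounded, so the clearing factor simply
cancels. -/
lemma iotaConv_clearAt_zero {k : ℕ} {ψ φ : Series n (Module.End ℂ W)} (hψ : ψ ∈ VO n W)
    (hφ : φ ∈ VO n W) (h : LocalAt k ψ φ) (w : W) (m : Exp n) :
    iotaConv 0 (fun i => m i - k) (clearAt k ψ φ w) = iotaConv 0 m (prodAt ψ φ w) := by
  refine (eq_iotaConv (mem_bddBelow_of_mem_laurent₂ (clearAt_mem hψ hφ h w) 0)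
    (iotaConv_mem m (prodAt_mem ψ hφ w)) (fun i => (m i).toNat) (fun i => (-m i).toNat + k)
    (fun i => by push_cast; omega) ?_).symm
  rw [act_xSubYPow_iotaConv (prodAt_mem ψ hφ w) (fun i => (m i).toNat + k)
    _ (fun i => by push_cast; omega), clearAt, ← act_mul, ← xSubYPow_add]
  rfl

/-- Independence of the clearing exponent: the least one, used by `iota`, may be replaced by one
coming from a locality exponent `k`. -/
lemma iota_eq_iotaConv {k : ℕ} {ψ φ : Series n (Module.End ℂ W)} (hψ : ψ ∈ VO n W)
    (hφ : φ ∈ VO n W) (h : LocalAt k ψ φ) (α : Fin n → ZMod 2) (m : Exp n) (w : W)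
    (a b : Exp n) :
    iota α (fun w' => mulSeries (subPow m) (opProd ψ φ w')) w a b =
      iotaConv α (fun i => m i - k) (clearAt k ψ φ w) (a, b) := by
  obtain ⟨N, hN⟩ := exists_int_le m
  have hF := fun w => clearAt_mem hψ hφ h w
  have hmul : ∀ (l : ℕ) (w : W),
      Function.uncurry (mulSeries (subPowConst n l) (mulSeries (subPow m) (opProd ψ φ w))) =
        act (xSubYPow fun _ => l) (iotaConv 0 m (prodAt ψ φ w)) := fun l w =>
    uncurry_mulSeries_subPowConst l _
  -- Here `k` handles the pole of the product, and `(-N).toNat` makes every `m i` nonnegative.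
  have hclear : ClearsPoles (k + (-N).toNat)
      fun w' => mulSeries (subPow m) (opProd ψ φ w') := by
    intro w
    rw [isLaurent₂_iff, hmul, act_xSubYPow_iotaConv (prodAt_mem ψ hφ w)
      ((fun i => (m i + (-N).toNat).toNat) + fun _ => k) _
      (fun i => by have := hN i; simp only [Pi.add_apply]; push_cast; omega),
      xSubYPow_add, act_mul]
    exact act_mem_laurent₂ (hF w) _
  have hmem := Nat.sInf_mem (s := {k : ℕ | ClearsPoles k
    fun w' => mulSeries (subPow m) (opProd ψ φ w')}) ⟨_, hclear⟩
  unfold iota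
  set l := sInf {k : ℕ | ClearsPoles k fun w' => mulSeries (subPow m) (opProd ψ φ w')}
  have hl : act (xSubYPow fun _ => l) (iotaConv 0 m (prodAt ψ φ w)) ∈ laurent₂ n W := by
    rw [← hmul]
    exact (isLaurent₂_iff _).1 (hmem w)
  change iotaConv α (fun _ => -(l : ℤ)) (Function.uncurry (mulSeries (subPowConst n l)
    (mulSeries (subPow m) (opProd ψ φ w)))) (a, b) = _
  rw [hmul]
  refine congrFun ?_ (a, b)
  refine eq_iotaConv (mem_bddBelow_of_mem_laurent₂ (hF w) α)
    (iotaConv_mem _ (mem_bddBelow_of_mem_laurent₂ hl α))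
    (fun i => (m i + (-N).toNat).toNat + l) ((fun _ => k + (-N).toNat) + fun _ => l)
    (fun i => by have := hN i; simp only [Pi.add_apply]; push_cast; omega) ?_
  rw [act_xSubYPow_iotaConv (mem_bddBelow_of_mem_laurent₂ hl α) (fun _ => k + (-N).toNat) _
    (fun i => by simp only [Pi.add_apply]; push_cast; omega), act_comm,
    act_xSubYPow_iotaConv (prodAt_mem ψ hφ w)
      ((fun i => (m i + (-N).toNat).toNat) + fun _ => k) _
      (fun i => by have := hN i; simp only [Pi.add_apply]; push_cast; omega), clearAt,
    ← act_mul, ← act_mul, ← xSubYPow_add, ← xSubYPow_add]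
  refine congrArg (fun r => act (xSubYPow r) (prodAt ψ φ w)) (funext fun i => ?_)
  simp only [Pi.add_apply]
  omega

lemma jacobiProducts_eq {k : ℕ} {ψ φ : Series n (Module.End ℂ W)} (hψ : ψ ∈ VO n W)
    (hφ : φ ∈ VO n W) (h : LocalAt k ψ φ) (w : W) (a b c : Exp n) :
    jacobiProducts ψ φ w a b c = jacobiSum k (clearAt k ψ φ w) c (a, b) := by
  simp only [jacobiProducts, jacobiSum, Finset.sum_apply, Pi.smul_apply]
  refine Finset.sum_congr rfl fun α _ => ?_
  rw [iota_eq_iotaConv hψ hφ h]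

/-- `χ` is the coefficient of `z^c` in the product `Y(ψ, z) φ` of vertex operators. -/
def IsProduct (ψ φ : Series n (Module.End ℂ W)) (c : Exp n) (χ : Series n (Module.End ℂ W)) :
    Prop :=
  ∀ b w, χ b w = jacobiProducts ψ φ w (-1) b c

lemma IsProduct.unique {ψ φ χ χ' : Series n (Module.End ℂ W)} {c : Exp n}
    (h : IsProduct ψ φ c χ) (h' : IsProduct ψ φ c χ') : χ = χ' :=
  funext fun b => LinearMap.ext fun w => (h b w).trans (h' b w).symm

lemma exists_isProduct {ψ φ : Series n (Module.End ℂ W)} (hψ : ψ ∈ VO n W) (hφ : φ ∈ VO n W)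
    (h : MutuallyLocal ψ φ) (c : Exp n) : ∃ χ ∈ VO n W, IsProduct ψ φ c χ := by
  obtain ⟨k, hk⟩ := (mutuallyLocal_iff ψ φ).1 h
  have hF := fun w => clearAt_mem hψ hφ hk w
  have hadd : ∀ w w', clearAt k ψ φ (w + w') = clearAt k ψ φ w + clearAt k ψ φ w' := by
    intro w w'
    rw [clearAt, clearAt, clearAt, ← map_add]
    congr 1
    funext g
    simp [prodAt]
  have hsmul : ∀ (t : ℂ) w, clearAt k ψ φ (t • w) = fun g => t • clearAt k ψ φ w g := by
    intro t w
    have h1 : clearAt k ψ φ (t • w) = t • clearAt k ψ φ w := by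
      rw [clearAt, clearAt, ← map_smul]
      congr 1
      funext g
      simp [prodAt]
    rw [h1]
    rfl
  refine ⟨fun b =>
    { toFun := fun w => jacobiSum k (clearAt k ψ φ w) c (-1, b)
      map_add' := fun w w' => by rw [hadd, jacobiSum_add (hF w) (hF w')]; rfl
      map_smul' := fun t w => by
        rw [hsmul]
        exact jacobiSum_comp_linear (LinearMap.lsmul ℂ W t) (hF w) k c _ },
    fun w => exists_bound_jacobiSum (hF w) k (-1) c, fun b w => ?_⟩
  rw [jacobiProducts_eq hψ hφ hk]
  rfl

/-- The Jacobi identity for vertex operators. -/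
lemma jacobiIterate_isProduct {ψ φ : Series n (Module.End ℂ W)} (hψ : ψ ∈ VO n W)
    (hφ : φ ∈ VO n W) (h : MutuallyLocal ψ φ) {χ : Exp n → Series n (Module.End ℂ W)}
    (hχ : ∀ c, IsProduct ψ φ c (χ c)) (w : W) (a b c : Exp n) :
    jacobiIterate (fun b c => χ c b w) a b c = jacobiProducts ψ φ w a b c := by
  obtain ⟨k, hk⟩ := (mutuallyLocal_iff ψ φ).1 h
  rw [jacobiProducts_eq hψ hφ hk, ← jacobiIterate_jacobiSum (clearAt_mem hψ hφ hk w)]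
  congr 1
  funext b c
  rw [hχ c, jacobiProducts_eq hψ hφ hk]

/-! ### Products are covariant. -/

section Covariance

/-- The derivation `∂_{x_i} + ∂_{y_i}`. -/
def totalDeriv (M : Type*) [AddCommGroup M] [Module ℂ M] (i : Fin n) :
    Module.End ℂ (Exp n × Exp n → M) where
  toFun f p := ((p.1 i + 1 : ℤ) : ℂ) • f (p.1 + Pi.single i 1, p.2) +
    ((p.2 i + 1 : ℤ) : ℂ) • f (p.1, p.2 + Pi.single i 1)
  map_add' f f' := by
    funext p
    simp only [Pi.add_apply, smul_add]
    abel
  map_smul' c f := by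
    funext p
    simp only [Pi.smul_apply, smul_add, RingHom.id_apply]
    rw [smul_comm c, smul_comm c]

lemma totalDeriv_apply (i : Fin n) (f : Exp n × Exp n → M) (a b : Exp n) :
    totalDeriv M i f (a, b) = ((a i + 1 : ℤ) : ℂ) • f (a + Pi.single i 1, b) +
      ((b i + 1 : ℤ) : ℂ) • f (a, b + Pi.single i 1) := rfl

/-- The derivation `∂_{x_i} + ∂_{y_i}` annihilates every `x_j - y_j`. -/
lemma totalDeriv_act_xSubY (i j : Fin n) (f : Exp n × Exp n → M) :
    totalDeriv M i (act (xSubY j) f) = act (xSubY j) (totalDeriv M i f) := by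
  funext ⟨a, b⟩
  simp only [totalDeriv_apply, act_xSubY_apply]
  rcases eq_or_ne i j with rfl | hij
  · simp only [add_sub_cancel_right, sub_add_cancel, Pi.sub_apply, Pi.single_eq_same]
    push_cast
    module
  · have hc : ∀ v : Exp n, v + Pi.single i 1 - Pi.single j 1 = v - Pi.single j 1 + Pi.single i 1 :=
      fun v => add_sub_right_comm _ _ _
    simp only [hc, Pi.sub_apply, Pi.single_eq_of_ne hij, sub_zero]
    module

lemma totalDeriv_act_xSubYPow (i : Fin n) (r : Fin n → ℕ) (f : Exp n × Exp n → M) :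
    totalDeriv M i (act (xSubYPow r) f) = act (xSubYPow r) (totalDeriv M i f) := by
  let S := (Subalgebra.centralizer ℂ {totalDeriv M i}).comap
    (act : AddMonoidAlgebra ℂ (Exp n × Exp n) →ₐ[ℂ] _)
  have hS : ∀ p, p ∈ S ↔ totalDeriv M i * act p = act p * totalDeriv M i := fun p => by
    simp [S, Subalgebra.mem_comap, Subalgebra.mem_centralizer_iff]
  have h : xSubYPow r ∈ S := prod_mem fun j _ => pow_mem
    ((hS _).2 (LinearMap.ext fun f => totalDeriv_act_xSubY i j f)) _
  exact LinearMap.congr_fun ((hS _).1 h) f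

lemma totalDeriv_mem {α : Fin n → ZMod 2} (i : Fin n) {f : Exp n × Exp n → M}
    (hf : f ∈ bddBelow M (expandDeg α)) : totalDeriv M i f ∈ bddBelow M (expandDeg α) := by
  obtain ⟨N, hN⟩ := hf
  refine ⟨N - 1, fun ⟨a, b⟩ hg j => ?_⟩
  have hs : (Pi.single i 1 : Exp n) j ≤ 1 := by
    rw [Pi.single_apply]; split_ifs <;> norm_num
  rw [totalDeriv_apply] at hg
  by_cases h : f (a + Pi.single i 1, b) = 0
  · have h' : f (a, b + Pi.single i 1) ≠ 0 := fun h' => hg (by simp [h, h'])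
    have := hN _ h' j
    rw [expandDeg_apply] at this ⊢
    simp only [Pi.add_apply] at this ⊢
    split_ifs at this ⊢ <;> linarith
  · have := hN _ h j
    rw [expandDeg_apply] at this ⊢
    simp only [Pi.add_apply] at this ⊢
    split_ifs at this ⊢ <;> linarith

lemma comp_linear_mem {ι G : Type*} [AddCommGroup G] {ℓ : ι → G →+ ℤ} (L : M →ₗ[ℂ] M')
    {f : G → M} (hf : f ∈ bddBelow M ℓ) : (fun g => L (f g)) ∈ bddBelow M' ℓ := by
  obtain ⟨N, hN⟩ := hf
  exact ⟨N, fun g hg => hN g fun h => hg (by simp only [h, map_zero])⟩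

/-- `[d, ψ(x)] = ∂_{x_i} ψ(x)`. -/
def IsCovariant (d : Module.End ℂ W) (i : Fin n) (ψ : Series n (Module.End ℂ W)) : Prop :=
  (fun m => d * ψ m - ψ m * d) = pderiv i ψ

lemma isCovariant_iff {d : Module.End ℂ W} {i : Fin n} {ψ : Series n (Module.End ℂ W)} :
    IsCovariant d i ψ ↔
      ∀ m w, d (ψ m w) = ((m i + 1 : ℤ) : ℂ) • ψ (m + Pi.single i 1) w + ψ m (d w) := by
  constructor
  · intro h m w
    have := LinearMap.congr_fun (congrFun h m) w
    exact sub_eq_iff_eq_add.1 this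
  · intro h
    funext m
    exact LinearMap.ext fun w => sub_eq_iff_eq_add.2 (h m w)

/-- Commutation with `d` acts on `ψ(x)φ(y)` as `∂_{x_i} + ∂_{y_i}`. This passes through each
expansion, by clearing denominators, and a residue in `x` kills `∂_{x_i}`. -/
lemma IsProduct.isCovariant {d : Module.End ℂ W} {i : Fin n} {ψ φ χ : Series n (Module.End ℂ W)}
    (hψ : ψ ∈ VO n W) (hφ : φ ∈ VO n W) (h : MutuallyLocal ψ φ) (hdψ : IsCovariant d i ψ)
    (hdφ : IsCovariant d i φ) {c : Exp n} (hχ : IsProduct ψ φ c χ) : IsCovariant d i χ := by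
  obtain ⟨k, hk⟩ := (mutuallyLocal_iff ψ φ).1 h
  rw [isCovariant_iff] at hdψ hdφ ⊢
  have hprod : ∀ w, (fun g => d (prodAt ψ φ w g)) =
      totalDeriv W i (prodAt ψ φ w) + prodAt ψ φ (d w) := by
    intro w
    funext ⟨a, b⟩
    simp only [Pi.add_apply, totalDeriv_apply, prodAt, hdψ, hdφ, map_add, map_smul]
    abel
  have hF := fun w α => mem_bddBelow_of_mem_laurent₂ (clearAt_mem hψ hφ hk w) α
  have hiota : ∀ (α : Fin n → ZMod 2) (m : Exp n) (w : W) (g : Exp n × Exp n),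
      d (iotaConv α m (clearAt k ψ φ w) g) =
        totalDeriv W i (iotaConv α m (clearAt k ψ φ w)) g +
          iotaConv α m (clearAt k ψ φ (d w)) g := by
    intro α m w
    refine congrFun (act_xSubYPow_injective (comp_linear_mem d (iotaConv_mem m (hF w α)))
      (add_mem (totalDeriv_mem i (iotaConv_mem m (hF w α))) (iotaConv_mem m (hF (d w) α)))
      (fun i => (-m i).toNat) ?_)
    have hrs : ∀ i, m i + ((-m i).toNat : ℤ) = ((m i).toNat : ℤ) := fun i => by omega
    change _ = act _ (totalDeriv W i (iotaConv α m (clearAt k ψ φ w)) +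
      iotaConv α m (clearAt k ψ φ (d w)))
    rw [map_add, ← totalDeriv_act_xSubYPow, act_iotaConv_clearAt hψ hφ hk _ α _ _ hrs,
      act_iotaConv_clearAt hψ hφ hk _ α _ _ hrs, act_comp_linear,
      act_iotaConv_clearAt hψ hφ hk _ α _ _ hrs, ← act_comp_linear, hprod, map_add,
      totalDeriv_act_xSubYPow]
  intro b w
  have hsum : d (jacobiSum k (clearAt k ψ φ w) c (-1, b)) =
      totalDeriv W i (jacobiSum k (clearAt k ψ φ w) c) (-1, b) +
        jacobiSum k (clearAt k ψ φ (d w)) c (-1, b) := by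
    simp only [jacobiSum, map_sum, map_smul, Finset.sum_apply, Pi.smul_apply, hiota, smul_add,
      Finset.sum_add_distrib]
  -- At the `x`-exponent `-1` the factor `a i + 1` of the `x`-derivative vanishes, leaving only the
  -- `y`-derivative.
  rw [hχ, hχ, hχ, jacobiProducts_eq hψ hφ hk, jacobiProducts_eq hψ hφ hk,
    jacobiProducts_eq hψ hφ hk, hsum, totalDeriv_apply]
  simp

end Covariance

/-! ### Products create vectors. -/

section Creation

lemma exists_of_act_xSubYPow_ne_zero {r : Fin n → ℕ} {f : Exp n × Exp n → M}
    {g : Exp n × Exp n} (h : act (xSubYPow r) f g ≠ 0) :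
    ∃ p : Exp n × Exp n, (∀ i, 0 ≤ p.1 i ∧ 0 ≤ p.2 i) ∧ f (g - p) ≠ 0 := by
  rw [← iotaConv_natCast 0] at h
  obtain ⟨p, hp⟩ : ∃ p : Exp n × Exp n,
      Function.uncurry (iotaPow 0 fun i => (r i : ℤ)) p • f (g - p) ≠ 0 := by
    by_contra! h'
    exact h (finsum_eq_zero_of_forall_eq_zero h')
  refine ⟨p, fun i => ?_, fun h => hp (by rw [h, smul_zero])⟩
  have h1 : iotaPow 0 (fun i => (r i : ℤ)) p.1 p.2 ≠ 0 :=
    fun h => hp (by simp [Function.uncurry_def, h])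
  exact nonneg_of_binomCoeff_natCast_ne_zero (binomCoeff_ne_zero_of_iotaPow h1 i)

/-- Nonnegativity in `x` is read off `φ(y)ψ(x)w`, and in `y` off `ψ(x)φ(y)w`; locality equates their
cleared forms. -/
lemma nonneg_of_clearAt_ne_zero {k : ℕ} {ψ φ : Series n (Module.End ℂ W)} (h : LocalAt k ψ φ)
    {w : W} (hψ : IsPower fun m => ψ m w) (hφ : IsPower fun m => φ m w) {g : Exp n × Exp n}
    (hg : clearAt k ψ φ w g ≠ 0) (i : Fin n) : 0 ≤ g.1 i ∧ 0 ≤ g.2 i := by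
  constructor
  · rw [clearAt, h w] at hg
    obtain ⟨p, hp, hne⟩ := exists_of_act_xSubYPow_ne_zero hg
    have := hψ (g - p).1 (fun h => hne (by simp only [revAt, h, map_zero])) i
    have := (hp i).1
    simp only [Prod.fst_sub, Pi.sub_apply] at *
    linarith
  · obtain ⟨p, hp, hne⟩ := exists_of_act_xSubYPow_ne_zero hg
    have := hφ (g - p).2 (fun h => hne (by simp only [prodAt, h, map_zero])) i
    have := (hp i).2
    simp only [Prod.snd_sub, Pi.sub_apply] at *
    linarith

lemma iotaPow_self_zero (m : Exp n) : iotaPow 0 m m 0 = 1 := by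
  simp [iotaPow, binomCoeff]

lemma IsProduct.creation {ψ φ χ : Series n (Module.End ℂ W)}
    (hψ : ψ ∈ VO n W) (hφ : φ ∈ VO n W) (h : MutuallyLocal ψ φ) {w : W}
    (hψw : IsPower fun m => ψ m w) (hφw : IsPower fun m => φ m w) {c : Exp n}
    (hχ : IsProduct ψ φ c χ) : IsPower (fun m => χ m w) ∧ χ 0 w = ψ c (φ 0 w) := by
  obtain ⟨k, hk⟩ := (mutuallyLocal_iff ψ φ).1 h
  have hN := fun g => nonneg_of_clearAt_ne_zero (g := g) hk hψw hφw
  have hne : ∀ (α : Fin n → ZMod 2) (m b : Exp n),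
      iotaConv α m (clearAt k ψ φ w) (-1, b) ≠ 0 → α = 0 ∧ ∀ i, 0 ≤ b i := by
    intro α m b hne
    have hbound := fun i => (bounds_of_iotaConv_ne_zero hN hne i).1
    -- If `α i ≠ 0`, the expansion has only nonnegative powers of `x_i`, hence no residue. Only the
    -- usual expansion survives.
    have hα : α = 0 := by
      by_contra hα
      obtain ⟨i, hi⟩ := Function.ne_iff.1 hα
      have := hbound i
      rw [if_neg (by simpa using hi)] at this
      simp at this
    subst hα
    exact ⟨rfl, fun i => by simpa using hbound i⟩
  have key : ∀ b, χ b w = iotaConv 0 (fun i => -c i - 1) (prodAt ψ φ w) (-1, b) := by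
    intro b
    rw [hχ, jacobiProducts_eq hψ hφ hk, jacobiSum, Finset.sum_apply, Finset.sum_eq_single 0,
      iotaConv_clearAt_zero hψ hφ hk w fun i => -c i - 1]
    · simp
    · intro α _ hα
      rw [Pi.smul_apply]
      by_contra h0
      exact hα (hne α _ b fun h => h0 (by rw [h, smul_zero])).1
    · simp
  constructor
  · intro b hb
    have hb' : χ b w ≠ 0 := hb
    rw [key, ← iotaConv_clearAt_zero hψ hφ hk w] at hb'
    exact (hne _ _ b hb').2
  · rw [key, iotaConv, conv, finsum_eq_single _ ((fun i => -c i - 1, 0) : Exp n × Exp n)]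
    · rw [Function.uncurry_apply_pair, iotaPow_self_zero, one_smul]
      have h1 : (-1 : Exp n) - (fun i => -c i - 1) = c := by
        funext i
        simp only [Pi.sub_apply, Pi.neg_apply, Pi.one_apply]
        ring
      simp [prodAt, h1]
    -- At `y`-exponent `0`, both `(x - y)^{-c-1}` and `φ(y)w` have nonnegative exponents, so both
    -- contribute `y^0`; the power of `x` is then forced.
    · intro p hp
      by_contra hne
      have h1 : iotaPow 0 (fun i => -c i - 1) p.1 p.2 ≠ 0 :=
        fun h => hne (by simp [Function.uncurry_def, h])
      have h2 : φ (-p.2) w ≠ 0 := fun h => hne (by simp [prodAt, h])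
      have h3 := fun i => binomCoeff_ne_zero_of_iotaPow h1 i
      have h4 : p.2 = 0 := funext fun i => by
        have h5 := nonneg_of_binomCoeff_ne_zero (h3 i)
        have h6 := hφw _ h2 i
        simp only [Pi.zero_apply, if_true, Pi.neg_apply] at h5 h6 ⊢
        omega
      refine hp (Prod.ext (funext fun i => ?_) h4)
      have := add_eq_of_binomCoeff_ne_zero (h3 i)
      rw [h4] at this
      simpa using this

end Creation

end

/-! ### Dong's lemma. -/

section

/-- To be applied with `A = t - x`, `D = x - y`, `E = t - y`. By the binomial theorem `(A +
D)^{k+r}` lies in the ideal generated by `A^k` and `D^r`, so modulo `I` it is a multiple of `A^k`.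
-/
lemma exists_prod_pow_mem {R ι : Type*} [CommRing R] [Fintype ι] (I : Ideal R) (A D E : ι → R)
    (hE : ∀ i, E i = A i + D i) (k l r : ℕ) (hAE : (∏ i, A i ^ k) * ∏ i, E i ^ l ∈ I)
    (hD : ∀ i, D i ^ r ∈ I) : ∏ i, E i ^ (k + r + l) ∈ I := by
  let q := Ideal.Quotient.mk I
  have h1 : ∀ i, ∃ P, q (E i ^ (k + r)) = P * q (A i ^ k) := by
    intro i
    have hmem : (A i + D i) ^ (k + r) ∈ Ideal.span {A i ^ k, D i ^ r} :=
      Ideal.add_pow_mem_of_pow_mem_of_le (m := k) (n := r) _ (Ideal.subset_span (by simp))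
        (Ideal.subset_span (by simp)) (by omega)
    obtain ⟨P, Q, h⟩ := Ideal.mem_span_pair.1 hmem
    refine ⟨q P, ?_⟩
    rw [hE, ← h, map_add, map_mul, map_mul, Ideal.Quotient.eq_zero_iff_mem.2 (hD i), mul_zero,
      add_zero]
  choose P hP using h1
  have h2 := Ideal.Quotient.eq_zero_iff_mem.2 hAE
  rw [map_mul, map_prod] at h2
  rw [← Ideal.Quotient.eq_zero_iff_mem]
  simp only [pow_add _ (k + r), Finset.prod_mul_distrib, map_mul]
  rw [map_prod]
  change (∏ i, q (E i ^ (k + r))) * _ = 0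
  simp only [hP, Finset.prod_mul_distrib]
  rw [mul_assoc, h2, mul_zero]

variable {n : ℕ} {W M : Type*} [AddCommGroup W] [Module ℂ W] [AddCommGroup M] [Module ℂ M]

/-- The exponents of monomials in three sets of variables `t`, `x`, `y`. -/
abbrev Exp₃ (n : ℕ) := Exp n × (Exp n × Exp n)

/-- Polynomials in `x` and `y`, among those in `t`, `x`, `y`. -/
def embXY (n : ℕ) : Exp n × Exp n →+ Exp₃ n := AddMonoidHom.inr _ _

/-- The substitution of `(t, x)` for `(x, y)`. -/
def embTX (n : ℕ) : Exp n × Exp n →+ Exp₃ n :=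
  (AddMonoidHom.fst _ _).prod ((AddMonoidHom.snd _ _).prod 0)

/-- The substitution of `(t, y)` for `(x, y)`. -/
def embTY (n : ℕ) : Exp n × Exp n →+ Exp₃ n :=
  (AddMonoidHom.fst _ _).prod (AddMonoidHom.prod 0 (AddMonoidHom.snd _ _))

/-- Substitution of variables in a Laurent polynomial. -/
abbrev subst (j : Exp n × Exp n →+ Exp₃ n) :
    AddMonoidAlgebra ℂ (Exp n × Exp n) →+* AddMonoidAlgebra ℂ (Exp₃ n) :=
  AddMonoidAlgebra.mapDomainRingHom ℂ j

lemma subst_TY_xSubY (i : Fin n) :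
    subst (embTY n) (xSubY i) = subst (embTX n) (xSubY i) + subst (embXY n) (xSubY i) := by
  simp [xSubY, embTY, embTX, embXY, map_sub]

lemma act_subst_TX (p : AddMonoidAlgebra ℂ (Exp n × Exp n)) (f : Exp₃ n → M) (e a b : Exp n) :
    act (subst (embTX n) p) f (e, a, b) = act p (fun h => f (h.1, h.2, b)) (e, a) := by
  have := congrFun (act_slice (embTX n) (0, 0, b) p f) (e, a)
  simpa [embTX] using this.symm

lemma act_subst_TY (p : AddMonoidAlgebra ℂ (Exp n × Exp n)) (f : Exp₃ n → M) (e a b : Exp n) :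
    act (subst (embTY n) p) f (e, a, b) = act p (fun h => f (h.1, a, h.2)) (e, b) := by
  have := congrFun (act_slice (embTY n) (0, a, 0) p f) (e, b)
  simpa [embTY] using this.symm

lemma act_subst_XY (p : AddMonoidAlgebra ℂ (Exp n × Exp n)) (f : Exp₃ n → M) (e : Exp n)
    (g : Exp n × Exp n) :
    act (subst (embXY n) p) f (e, g) = act p (fun h => f (e, h)) g := by
  have := congrFun (act_slice (embXY n) (e, 0) p f) g
  simpa [embXY] using this.symm

/-- The series in `t`, `x`, `y` all of whose coefficients in `t` lie in the domain of `ι_α`. -/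
def sliceBdd (M : Type*) [AddCommGroup M] [Module ℂ M] (α : Fin n → ZMod 2) :
    Submodule ℂ (Exp₃ n → M) where
  carrier := {f | ∀ e, (fun g => f (e, g)) ∈ bddBelow M (expandDeg α)}
  add_mem' hf hf' e := add_mem (hf e) (hf' e)
  zero_mem' _ := zero_mem _
  smul_mem' c _ hf e := Submodule.smul_mem _ c (hf e)

lemma act_mem_sliceBdd {α : Fin n → ZMod 2} {f : Exp₃ n → M} (hf : f ∈ sliceBdd M α)
    (p : AddMonoidAlgebra ℂ (Exp₃ n)) : act p f ∈ sliceBdd M α := by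
  induction p using AddMonoidAlgebra.induction_linear with
  | zero => simp
  | add p q hp hq => rw [act_add]; exact add_mem hp hq
  | single u c =>
    intro e
    have : (fun g => act (AddMonoidAlgebra.single u c) f (e, g)) =
        act (AddMonoidAlgebra.single u.2 c) (fun g => f (e - u.1, g)) := by
      funext g
      rw [act_single, act_single]
      rfl
    rw [this]
    exact act_mem_bddBelow (hf _) _

lemma eq_zero_of_act_subst_XY {α : Fin n → ZMod 2} {f : Exp₃ n → M} (hf : f ∈ sliceBdd M α)
    (s : Fin n → ℕ) (h : act (subst (embXY n) (xSubYPow s)) f = 0) : f = 0 := by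
  funext ⟨e, g⟩
  refine congrFun (eq_zero_of_act_xSubYPow (hf e) s ?_) g
  funext g
  rw [← act_subst_XY, h]
  rfl

/-- The series `χ(t) f_w(x, y) - f_{χ(t) w}(x, y)` for a family `f` of series indexed by `w ∈ W`. -/
def bracketSeries (χ : Series n (Module.End ℂ W)) (f : W → Exp n × Exp n → W) (w : W) :
    Exp₃ n → W :=
  fun p => χ p.1 (f w p.2) - f (χ p.1 w) p.2

lemma act_bracketSeries (χ : Series n (Module.End ℂ W)) (f : W → Exp n × Exp n → W) (w : W)
    (p : AddMonoidAlgebra ℂ (Exp n × Exp n)) :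
    act (subst (embXY n) p) (bracketSeries χ f w) =
      bracketSeries χ (fun w => act p (f w)) w := by
  funext ⟨e, g⟩
  rw [act_subst_XY]
  change act p ((fun g => χ e (f w g)) - f (χ e w)) g = _
  rw [map_sub, act_comp_linear]
  rfl

/-- Write `[χ, ψφ] = [χ, ψ]φ + ψ[χ, φ]`: each factor of the polynomial kills one summand. -/
lemma act_bracketSeries_prodAt {k l : ℕ} {χ ψ φ : Series n (Module.End ℂ W)}
    (hψ : LocalAt k χ ψ) (hφ : LocalAt l χ φ) (w : W) :
    act (subst (embTX n) (xSubYPow fun _ => k) * subst (embTY n) (xSubYPow fun _ => l))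
      (bracketSeries χ (prodAt ψ φ) w) = 0 := by
  let g₁ : Exp₃ n → W := fun p =>
    χ p.1 (ψ p.2.1 (φ p.2.2 w)) - ψ p.2.1 (χ p.1 (φ p.2.2 w))
  let g₂ : Exp₃ n → W := fun p =>
    ψ p.2.1 (χ p.1 (φ p.2.2 w)) - ψ p.2.1 (φ p.2.2 (χ p.1 w))
  have h₁ : act (subst (embTX n) (xSubYPow fun _ => k)) g₁ = 0 := by
    funext ⟨e, a, b⟩
    rw [act_subst_TX]
    change act _ (prodAt χ ψ (φ b w) - revAt χ ψ (φ b w)) (e, a) = 0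
    rw [map_sub, hψ, sub_self]
    rfl
  have h₂ : act (subst (embTY n) (xSubYPow fun _ => l)) g₂ = 0 := by
    funext ⟨e, a, b⟩
    rw [act_subst_TY]
    have : (fun h : Exp n × Exp n => g₂ (h.1, a, h.2)) =
        fun h => ψ a ((prodAt χ φ w - revAt χ φ w) h) := by
      funext h
      simp [g₂, prodAt, revAt]
    rw [this, act_comp_linear, map_sub, hφ, sub_self]
    simp
  have h : bracketSeries χ (prodAt ψ φ) w = g₁ + g₂ := by
    funext p
    simp [bracketSeries, prodAt, g₁, g₂]
  rw [h, map_add, act_mul _ _ g₂, h₂, mul_comm, act_mul, h₁]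
  simp

/-- Dong's lemma. -/
lemma IsProduct.mutuallyLocal {χ ψ φ θ : Series n (Module.End ℂ W)} (hψ : ψ ∈ VO n W)
    (hφ : φ ∈ VO n W) (h : MutuallyLocal ψ φ) (hχψ : MutuallyLocal χ ψ)
    (hχφ : MutuallyLocal χ φ) {c : Exp n} (hθ : IsProduct ψ φ c θ) : MutuallyLocal χ θ := by
  obtain ⟨k, hk⟩ := (mutuallyLocal_iff ψ φ).1 h
  obtain ⟨k₁, hk₁⟩ := (mutuallyLocal_iff χ ψ).1 hχψ
  obtain ⟨k₂, hk₂⟩ := (mutuallyLocal_iff χ φ).1 hχφ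
  have hF := fun w => clearAt_mem hψ hφ hk w
  let B := fun c => bracketSeries χ fun w => jacobiSum k (clearAt k ψ φ w) c
  have hB : ∀ w, act (subst (embTX n) (xSubYPow fun _ => k₁) *
      subst (embTY n) (xSubYPow fun _ => k₂)) (B c w) = 0 := by
    intro w
    have hsum : B c w = ∑ α : Fin n → ZMod 2, (-1 : ℂ) ^ (hammingNorm α) •
        bracketSeries χ (fun w => iotaConv α (fun i => -c i - 1 - k) (clearAt k ψ φ w)) w := by
      funext p
      simp only [B, bracketSeries, jacobiSum, Finset.sum_apply, Pi.smul_apply, map_sum, map_smul,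
        smul_sub, Finset.sum_sub_distrib]
    rw [hsum, map_sum]
    refine Finset.sum_eq_zero fun α _ => ?_
    rw [map_smul]
    convert smul_zero _
    let m : Exp n := fun i => -c i - 1 - k
    have hrs : ∀ i, m i + ((-m i).toNat : ℤ) = ((m i).toNat : ℤ) := fun i => by omega
    -- For one `α` at a time, multiplying by a power of `x - y` reduces the claim to `ψ(x)φ(y)`;
    -- that power can then be cancelled.
    refine eq_zero_of_act_subst_XY (α := α) (act_mem_sliceBdd (fun e => ?_) _)
      (fun i => (-m i).toNat) ?_
    · exact sub_mem (comp_linear_mem (χ e)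
        (iotaConv_mem _ (mem_bddBelow_of_mem_laurent₂ (hF w) α)))
        (iotaConv_mem m (mem_bddBelow_of_mem_laurent₂ (hF (χ e w)) α))
    · rw [act_comm, act_bracketSeries]
      have : (fun w => act (xSubYPow fun i => (-m i).toNat) (iotaConv α m (clearAt k ψ φ w))) =
          fun w => act (xSubYPow ((fun i => (m i).toNat) + fun _ => k)) (prodAt ψ φ w) :=
        funext fun w => act_iotaConv_clearAt hψ hφ hk w α _ _ hrs
      change act _ (bracketSeries χ (fun w => act (xSubYPow fun i => (-m i).toNat)
        (iotaConv α m (clearAt k ψ φ w))) w) = 0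
      rw [this, ← act_bracketSeries, act_comm, act_bracketSeries_prodAt hk₁ hk₂, map_zero]
  have hD : ∀ (i : Fin n) (r : ℕ) (c : Exp n) (w : W),
      act (subst (embXY n) (xSubY i) ^ r) (B c w) = B (c - r • Pi.single i 1) w := by
    intro i r
    induction r with
    | zero => intro c w; simp
    | succ r ih =>
      intro c w
      rw [pow_succ', act_mul, ih, act_bracketSeries, succ_nsmul, ← sub_sub]
      simp only [← jacobiSum_sub_single (hF _)]
      rfl
  -- Multiplying by `(x_i - y_i)^{(-N).toNat}` lowers `c i` by at least `c i + k + 1`, hence below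
  -- `-k`, where `jacobiSum_eq_zero` applies.
  obtain ⟨N, hN⟩ := exists_int_le fun i => -c i - k - 1
  refine (mutuallyLocal_iff χ θ).2 ⟨k₁ + (-N).toNat + k₂, fun w => ?_⟩
  -- The annihilator of the bracket contains the products needed by `exists_prod_pow_mem`, so it
  -- contains a power of `t - y` alone. Such a factor commutes with the residue in `x`.
  let I : Ideal (AddMonoidAlgebra ℂ (Exp₃ n)) :=
    { carrier := {p | act p (B c w) = 0}
      add_mem' := fun {p q} hp hq => by
        rw [Set.mem_ofPred_eq, act_add, hp, hq, add_zero]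
      zero_mem' := by simp
      smul_mem' := fun p q hq => by
        rw [Set.mem_ofPred_eq, smul_eq_mul, act_mul, hq, map_zero] }
  have hmem := exists_prod_pow_mem I (fun i => subst (embTX n) (xSubY i))
    (fun i => subst (embXY n) (xSubY i)) (fun i => subst (embTY n) (xSubY i)) subst_TY_xSubY
    k₁ k₂ (-N).toNat (by
      change act _ (B c w) = 0
      simpa only [xSubYPow, map_prod, map_pow] using hB w) (fun i => by
      change act _ (B c w) = 0
      rw [hD]
      have hi := hN i
      have : ∀ w, jacobiSum k (clearAt k ψ φ w) (c - (-N).toNat • Pi.single i 1) = 0 := fun w =>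
        jacobiSum_eq_zero _ k (i := i) (by
          rw [Pi.sub_apply, Pi.smul_apply, Pi.single_eq_same, nsmul_eq_mul, mul_one]
          omega)
      funext p
      simp only [B, bracketSeries, this, Pi.zero_apply, map_zero, sub_zero])
  have hzero : act (subst (embTY n) (xSubYPow fun _ => k₁ + (-N).toNat + k₂)) (B c w) = 0 := by
    change act _ (B c w) = 0 at hmem
    simpa only [xSubYPow, map_prod, map_pow] using hmem
  rw [← sub_eq_zero, ← map_sub]
  funext ⟨e, b⟩
  have := congrFun hzero (e, -1, b)
  rw [act_subst_TY] at this
  have hslice : prodAt χ θ w - revAt χ θ w = fun h => B c w (h.1, -1, h.2) := by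
    funext h
    simp only [B, bracketSeries, Pi.sub_apply, prodAt, revAt, hθ _ _,
      jacobiProducts_eq hψ hφ hk]
  rw [hslice, this]
  rfl

end

/-! ### The state-field correspondence. -/

section

variable {n : ℕ} {W : Type*} [AddCommGroup W] [Module ℂ W]

lemma MutuallyLocal.symm {ψ φ : Series n (Module.End ℂ W)} (h : MutuallyLocal ψ φ) :
    MutuallyLocal φ ψ := by
  obtain ⟨k, hk⟩ := (mutuallyLocal_iff ψ φ).1 h
  refine (mutuallyLocal_iff φ ψ).2 ⟨k, fun w => ?_⟩
  let σ : Exp n × Exp n →+ Exp n × Exp n := (AddEquiv.prodComm : _ ≃+ _).toAddMonoidHom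
  have hσ : ∀ i, AddMonoidAlgebra.mapDomainRingHom ℂ σ (xSubY i) = (-1) * xSubY i := by
    intro i
    simp [xSubY, σ, map_sub]
  have hpow : ∃ q, AddMonoidAlgebra.mapDomainRingHom ℂ σ (xSubYPow fun _ => k) =
      q * xSubYPow fun _ => k := by
    refine ⟨∏ _i : Fin n, (-1) ^ k, ?_⟩
    simp only [xSubYPow, map_prod, map_pow, hσ, mul_pow, Finset.prod_mul_distrib]
  obtain ⟨q, hq⟩ := hpow
  have h1 : prodAt φ ψ w - revAt φ ψ w =
      fun h => (revAt ψ φ w - prodAt ψ φ w) (0 + σ h) := by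
    funext h
    rw [zero_add]
    rfl
  rw [← sub_eq_zero, ← map_sub, h1, act_slice, hq]
  funext h
  rw [act_mul, map_sub, hk, sub_self, map_zero]
  rfl

/-- The operators that are local with `φ`. -/
def localWith (φ : Series n (Module.End ℂ W)) : Submodule ℂ (Series n (Module.End ℂ W)) where
  carrier := {ψ | MutuallyLocal ψ φ}
  add_mem' := by
    intro ψ ψ' h h'
    obtain ⟨k, hk⟩ := (mutuallyLocal_iff ψ φ).1 h
    obtain ⟨l, hl⟩ := (mutuallyLocal_iff ψ' φ).1 h'
    refine (mutuallyLocal_iff _ φ).2 ⟨max k l, fun w => ?_⟩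
    have h1 : prodAt (ψ + ψ') φ w = prodAt ψ φ w + prodAt ψ' φ w := rfl
    have h2 : revAt (ψ + ψ') φ w = revAt ψ φ w + revAt ψ' φ w := by
      funext g
      simp [revAt]
    rw [h1, h2, map_add, map_add, hk.mono (le_max_left k l) w, hl.mono (le_max_right k l) w]
  zero_mem' := (mutuallyLocal_iff _ φ).2 ⟨0, fun w => by
    congr 1
    funext g
    simp [prodAt, revAt]⟩
  smul_mem' := by
    intro t ψ h
    obtain ⟨k, hk⟩ := (mutuallyLocal_iff ψ φ).1 h
    refine (mutuallyLocal_iff _ φ).2 ⟨k, fun w => ?_⟩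
    have h1 : prodAt (t • ψ) φ w = t • prodAt ψ φ w := rfl
    have h2 : revAt (t • ψ) φ w = t • revAt ψ φ w := by
      funext g
      simp [revAt]
    rw [h1, h2, map_smul, map_smul, hk w]

lemma mem_localWith {ψ φ : Series n (Module.End ℂ W)} :
    ψ ∈ localWith φ ↔ MutuallyLocal ψ φ := Iff.rfl

lemma mutuallyLocal_one (φ : Series n (Module.End ℂ W)) :
    MutuallyLocal (Pi.single 0 1) φ := by
  refine (mutuallyLocal_iff _ φ).2 ⟨0, fun w => ?_⟩
  congr 1
  funext g
  rcases eq_or_ne g.1 0 with h | h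
  · simp [prodAt, revAt, h]
  · simp [prodAt, revAt, Pi.single_eq_of_ne h]

lemma one_mem_VO : (Pi.single 0 1 : Series n (Module.End ℂ W)) ∈ VO n W := by
  intro w
  refine ⟨0, fun m hm i => ?_⟩
  rcases eq_or_ne m 0 with rfl | h
  · simp
  · exact absurd (by simp [Pi.single_eq_of_ne h]) hm

lemma isCovariant_one (d : Module.End ℂ W) (i : Fin n) :
    IsCovariant d i (Pi.single 0 1 : Series n (Module.End ℂ W)) := by
  refine isCovariant_iff.2 fun m w => ?_
  have h1 : ((m i + 1 : ℤ) : ℂ) •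
      (Pi.single 0 1 : Series n (Module.End ℂ W)) (m + Pi.single i 1) w = 0 := by
    rcases eq_or_ne (m + Pi.single i 1) 0 with h | h
    · have := congrFun h i
      simp only [Pi.add_apply, Pi.single_eq_same, Pi.zero_apply] at this
      rw [this]
      simp
    · simp [Pi.single_eq_of_ne h]
  rw [h1, zero_add]
  rcases eq_or_ne m 0 with rfl | h
  · simp
  · simp [Pi.single_eq_of_ne h]

lemma isPower_one (w : W) :
    IsPower fun m => (Pi.single 0 1 : Series n (Module.End ℂ W)) m w := by
  intro m hm i
  rcases eq_or_ne m 0 with rfl | h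
  · simp
  · exact absurd (by simp [Pi.single_eq_of_ne h]) hm

/-- The vertex operators that are covariant with respect to `d`, create a vector from `one`, and
are local with every member of `S`. -/
def fieldSpace (d : Fin n → Module.End ℂ W) (one : W) (S : Set (Series n (Module.End ℂ W))) :
    Submodule ℂ (Series n (Module.End ℂ W)) where
  carrier := {ψ | ψ ∈ VO n W ∧ (∀ i, IsCovariant (d i) i ψ) ∧ IsPower (fun m => ψ m one) ∧
    ∀ φ ∈ S, ψ ∈ localWith φ}
  add_mem' := by
    rintro ψ ψ' ⟨h1, h2, h3, h4⟩ ⟨h1', h2', h3', h4'⟩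
    refine ⟨add_mem h1 h1', fun i => isCovariant_iff.2 fun m w => ?_, fun m hm i => ?_,
      fun φ hφ => add_mem (h4 φ hφ) (h4' φ hφ)⟩
    · simp only [Pi.add_apply, LinearMap.add_apply, map_add, isCovariant_iff.1 (h2 i),
        isCovariant_iff.1 (h2' i), smul_add]
      abel
    · by_cases h : ψ m one = 0
      · exact h3' m (fun h' => hm (by simp [h, h'])) i
      · exact h3 m h i
  zero_mem' := ⟨zero_mem _, fun i => isCovariant_iff.2 fun m w => by simp,
    fun m hm => absurd rfl hm, fun φ _ => zero_mem _⟩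
  smul_mem' := by
    rintro t ψ ⟨h1, h2, h3, h4⟩
    refine ⟨Submodule.smul_mem _ t h1, fun i => isCovariant_iff.2 fun m w => ?_, fun m hm i => ?_,
      fun φ hφ => Submodule.smul_mem _ t (h4 φ hφ)⟩
    · simp only [Pi.smul_apply, LinearMap.smul_apply, map_smul, isCovariant_iff.1 (h2 i),
        smul_add]
      rw [smul_comm t]
    · exact h3 m (fun h => hm (by simp [h])) i

variable {d : Fin n → Module.End ℂ W} {one : W} {S : Set (Series n (Module.End ℂ W))}

lemma one_mem_fieldSpace : Pi.single 0 1 ∈ fieldSpace d one S :=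
  ⟨one_mem_VO, fun i => isCovariant_one (d i) i, isPower_one one, fun φ _ => mutuallyLocal_one φ⟩

lemma exists_isProduct_mem_fieldSpace {ψ φ : Series n (Module.End ℂ W)}
    (hψ : ψ ∈ fieldSpace d one S) (hφ : φ ∈ fieldSpace d one S) (h : MutuallyLocal ψ φ)
    (c : Exp n) :
    ∃ θ ∈ fieldSpace d one S, IsProduct ψ φ c θ ∧ θ 0 one = ψ c (φ 0 one) := by
  obtain ⟨θ, hθ, hp⟩ := exists_isProduct hψ.1 hφ.1 h c
  obtain ⟨h1, h2⟩ := hp.creation hψ.1 hφ.1 h hψ.2.2.1 hφ.2.2.1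
  exact ⟨θ, ⟨hθ, fun i => hp.isCovariant hψ.1 hφ.1 h (hψ.2.1 i) (hφ.2.1 i), h1, fun χ hχ =>
    MutuallyLocal.symm (hp.mutuallyLocal hψ.1 hφ.1 h (MutuallyLocal.symm (hψ.2.2.2 χ hχ))
      (MutuallyLocal.symm (hφ.2.2.2 χ hχ)))⟩, hp, h2⟩

/-- Covariance with `d i one = 0` gives `m_i • ψ m one = d i (ψ (m - e_i) one)`. Induction on total
degree divides by `m_i ≠ 0`. -/
lemma eq_zero_of_creation (hvac : ∀ i, d i one = 0) {ψ : Series n (Module.End ℂ W)}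
    (hd : ∀ i, IsCovariant (d i) i ψ) (hpow : IsPower fun m => ψ m one) (h0 : ψ 0 one = 0)
    (m : Exp n) : ψ m one = 0 := by
  have key : ∀ (s : ℕ) (m : Exp n), (∀ i, 0 ≤ m i) → ∑ i, (m i).toNat = s → ψ m one = 0 := by
    intro s
    induction s with
    | zero =>
      intro m hm hs
      have : m = 0 := funext fun i => by
        have h1 := (Finset.sum_eq_zero_iff.1 hs) i (Finset.mem_univ i)
        have h2 := hm i
        simp only [Pi.zero_apply]
        omega
      exact this ▸ h0
    | succ s ih =>
      intro m hm hs
      obtain ⟨i, -, hi⟩ := Finset.exists_ne_zero_of_sum_ne_zero (by omega :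
        ∑ i, (m i).toNat ≠ 0)
      have h1 := isCovariant_iff.1 (hd i) (m - Pi.single i 1) one
      rw [sub_add_cancel, hvac, map_zero, add_zero, ih (m - Pi.single i 1), map_zero] at h1
      · refine (smul_eq_zero.1 h1.symm).resolve_left ?_
        simp only [Pi.sub_apply, Pi.single_eq_same, sub_add_cancel, Int.cast_eq_zero]
        omega
      · intro j
        rcases eq_or_ne j i with rfl | hj
        · simp only [Pi.sub_apply, Pi.single_eq_same]
          omega
        · simpa [Pi.single_eq_of_ne hj] using hm j
      · rw [← Finset.add_sum_erase _ _ (Finset.mem_univ i)] at hs ⊢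
        have : ∑ j ∈ Finset.univ.erase i, ((m - Pi.single i 1 : Exp n) j).toNat =
            ∑ j ∈ Finset.univ.erase i, (m j).toNat :=
          Finset.sum_congr rfl fun j hj => by simp [Finset.ne_of_mem_erase hj]
        rw [this]
        simp only [Pi.sub_apply, Pi.single_eq_same]
        omega
  by_contra h
  exact h (key _ m (hpow m h) rfl)

/-- Goddard's uniqueness argument. -/
lemma eq_zero_of_mem_fieldSpace (hvac : ∀ i, d i one = 0) (hSVO : ∀ φ ∈ S, φ ∈ VO n W)
    (hgen : ∀ P : Submodule ℂ W, one ∈ P → (∀ φ ∈ S, ∀ c, ∀ v ∈ P, φ c v ∈ P) → P = ⊤)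
    {ψ : Series n (Module.End ℂ W)} (hψ : ψ ∈ fieldSpace d one S) (h0 : ψ 0 one = 0) :
    ψ = 0 := by
  let P : Submodule ℂ W := ⨅ m, LinearMap.ker (ψ m)
  have hP : ∀ v, v ∈ P ↔ ∀ m, ψ m v = 0 := fun v => by simp [P, Submodule.mem_iInf]
  have htop : P = ⊤ := by
    refine hgen P ((hP _).2 (eq_zero_of_creation hvac hψ.2.1 hψ.2.2.1 h0)) fun φ hφ c v hv => ?_
    obtain ⟨k, hk⟩ := (mutuallyLocal_iff ψ φ).1 (hψ.2.2.2 φ hφ)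
    have hrev : revAt ψ φ v = 0 := by
      funext g
      simp [revAt, (hP v).1 hv]
    -- Locality leaves `(x - y)^k ψ(x)φ(y)v = 0`, and the factor cancels because the product is
    -- bounded below in `y`.
    have hprod : prodAt ψ φ v = 0 :=
      eq_zero_of_act_xSubYPow (prodAt_mem ψ (hSVO φ hφ) v) (fun _ => k) (by
        rw [hk v, hrev, map_zero])
    exact (hP _).2 fun m => congrFun hprod (m, c)
  funext m
  refine LinearMap.ext fun v => (hP v).1 (htop ▸ Submodule.mem_top) m

/-- The vector created by a vertex operator. -/
def stateMap (d : Fin n → Module.End ℂ W) (one : W) (S : Set (Series n (Module.End ℂ W))) :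
    fieldSpace d one S →ₗ[ℂ] W :=
  (LinearMap.applyₗ one ∘ₗ LinearMap.proj 0) ∘ₗ (fieldSpace d one S).subtype

lemma stateMap_apply (ψ : fieldSpace d one S) :
    stateMap d one S ψ = (ψ : Series n (Module.End ℂ W)) 0 one := rfl

lemma stateMap_bijective (hvac : ∀ i, d i one = 0) (hS : S ⊆ fieldSpace d one S)
    (hgen : ∀ P : Submodule ℂ W, one ∈ P → (∀ φ ∈ S, ∀ c, ∀ v ∈ P, φ c v ∈ P) → P = ⊤) :
    Function.Bijective (stateMap d one S) := by
  constructor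
  · refine (injective_iff_map_eq_zero _).2 fun ψ h => Subtype.ext ?_
    exact eq_zero_of_mem_fieldSpace hvac (fun φ hφ => (hS hφ).1) hgen ψ.2 h
  · rw [← LinearMap.range_eq_top]
    -- The range is stable under `φ c`: the product of `φ` and `ψ` at `c` creates `φ c (ψ 0 one)`.
    refine hgen _ ⟨⟨_, one_mem_fieldSpace⟩, by simp [stateMap_apply]⟩ ?_
    rintro φ hφ c _ ⟨ψ, rfl⟩
    obtain ⟨θ, hθ, -, h⟩ := exists_isProduct_mem_fieldSpace (hS hφ) ψ.2
      (MutuallyLocal.symm (ψ.2.2.2.2 φ hφ)) c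
    exact ⟨⟨θ, hθ⟩, h⟩

/-- A vector space generated from the vacuum by pairwise local, creative and covariant vertex
operators is a vertex algebra, in which these operators belong to the vectors they create. -/
lemma exists_vertexAlgebra (hvac : ∀ i, d i one = 0) (hS : S ⊆ fieldSpace d one S)
    (hgen : ∀ P : Submodule ℂ W, one ∈ P → (∀ φ ∈ S, ∀ c, ∀ v ∈ P, φ c v ∈ P) → P = ⊤) :
    ∃ A : GnVertexAlgebra n W, A.vac = one ∧ ∀ φ ∈ S, A.Y (φ 0 one) = φ := by
  let e := LinearEquiv.ofBijective _ (stateMap_bijective hvac hS hgen)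
  let Y : W →ₗ[ℂ] Series n (Module.End ℂ W) := (fieldSpace d one S).subtype ∘ₗ e.symm.toLinearMap
  have hY : ∀ v, Y v ∈ fieldSpace d one S := fun v => (e.symm v).2
  have hstate : ∀ v, Y v 0 one = v := fun v => e.apply_symm_apply v
  have huniq : ∀ ψ ∈ fieldSpace d one S, Y (ψ 0 one) = ψ := fun ψ hψ =>
    congrArg Subtype.val (e.symm_apply_apply ⟨ψ, hψ⟩)
  have hYone : Y one = Pi.single 0 1 := by
    simpa using huniq _ one_mem_fieldSpace
  have hprod : ∀ u v, MutuallyLocal (Y u) (Y v) → ∀ c, IsProduct (Y u) (Y v) c (Y (Y u c v)) := by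
    intro u v h c
    obtain ⟨θ, hθ, hp, h0⟩ := exists_isProduct_mem_fieldSpace (hY u) (hY v) h c
    rw [hstate] at h0
    rwa [← h0, huniq θ hθ]
  have hlocal : ∀ u v, MutuallyLocal (Y u) (Y v) := by
    intro u v
    -- Membership in `fieldSpace` gives locality only with `S`. Dong's lemma, applied to products
    -- with generators, extends it to all `Y v`.
    have htop : (localWith (Y u)).comap Y = ⊤ := by
      refine hgen _ ?_ fun φ hφ c v hv => ?_
      · rw [Submodule.mem_comap, hYone]
        exact mutuallyLocal_one _
      · have h1 : MutuallyLocal φ (Y v) := MutuallyLocal.symm ((hY v).2.2.2 φ hφ)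
        rw [← huniq φ (hS hφ)] at h1
        have h2 := (hprod _ _ h1 c).mutuallyLocal (hY _).1 (hY _).1 h1
          (χ := Y u) (by rw [huniq φ (hS hφ)]; exact (hY u).2.2.2 φ hφ)
          (MutuallyLocal.symm (mem_localWith.1 hv))
        rw [huniq φ (hS hφ)] at h2
        exact MutuallyLocal.symm h2
    have hv : v ∈ (localWith (Y u)).comap Y := htop ▸ Submodule.mem_top
    exact MutuallyLocal.symm hv
  exact ⟨{  Y := Y
            vac := one
            truncation := fun u => (hY u).1
            vacuum := hYone
            creation := fun v => (hY v).2.2.1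
            creation_limit := hstate
            locality := hlocal
            jacobi := fun u v => jacobiIterate_isProduct (hY u).1 (hY v).1 (hlocal u v)
              (hprod u v (hlocal u v)) }, rfl, fun φ hφ => huniq φ (hS hφ)⟩

/-- The residue in `x` of the Jacobi identity shows that `Y(u)` and `Y(v)` determine `Y(u_c v)`. -/
lemma GnVertexAlgebra.isProduct (A : GnVertexAlgebra n W) (u v : W) (c : Exp n) :
    IsProduct (A.Y u) (A.Y v) c (A.Y (A.Y u c v)) := by
  intro b w
  rw [← A.jacobi, jacobiIterate_neg_one]

lemma GnVertexAlgebra.eq_of_generators {A B : GnVertexAlgebra n W} (U : Set W)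
    (hvac : A.vac = B.vac) (hY : ∀ u ∈ U, A.Y u = B.Y u)
    (hgen : ∀ P : Submodule ℂ W, A.vac ∈ P → (∀ u ∈ U, ∀ c, ∀ v ∈ P, A.Y u c v ∈ P) → P = ⊤) :
    A = B := by
  have htop : LinearMap.eqLocus A.Y B.Y = ⊤ := by
    refine hgen _ ?_ fun u hu c v hv => ?_
    · rw [LinearMap.mem_eqLocus, A.vacuum, hvac, B.vacuum]
    · rw [LinearMap.mem_eqLocus] at hv ⊢
      have h := B.isProduct u v c
      rw [← hY u hu, ← hv] at h
      exact (A.isProduct u v c).unique h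
  exact GnVertexAlgebra.ext (LinearMap.eqLocus_eq_top.1 htop) hvac

end

end

end GnVertex

theorem proposition4p20 (n : ℕ) (hn : 0 < n)
    {V : Type*} [AddCommGroup V] [Module ℂ V]
    (d : Fin n → Module.End ℂ V) (one : V)
    (U : Submodule ℂ V) (Y : U →ₗ[ℂ] VO n V)
    -- `V` is generated from `𝟏` by the modes `u_m`, `u ∈ U`, `m ∈ ℤⁿ`
    (hgen : ∀ P : Submodule ℂ V, one ∈ P →
      (∀ (u : U) (m : Fin n → ℤ), ∀ v ∈ P, mode (Y u : Series n (Module.End ℂ V)) m v ∈ P) →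
      P = ⊤)
    -- `Y(u, x) 𝟏 ∈ V[[x]]` with constant term `u`
    (hcreation : ∀ u : U, IsPower (fun m => (Y u : Series n (Module.End ℂ V)) m one))
    (hlimit : ∀ u : U, (Y u : Series n (Module.End ℂ V)) 0 one = u)
    -- `[d_i, Y(u, x)] = ∂_{x_i} Y(u, x)`
    (hderiv : ∀ (u : U) (i : Fin n),
      (fun m => d i * (Y u : Series n (Module.End ℂ V)) m -
          (Y u : Series n (Module.End ℂ V)) m * d i) =
        pderiv i (Y u : Series n (Module.End ℂ V)))
    (hlocal : ∀ u v : U,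
      MutuallyLocal (Y u : Series n (Module.End ℂ V)) (Y v : Series n (Module.End ℂ V)))
    (hvac : ∀ i, d i one = 0) :
    ∃! A : GnVertexAlgebra n V,
      A.vac = one ∧ ∀ u : U, A.Y (u : V) = (Y u : Series n (Module.End ℂ V)) := by
  let S : Set (Series n (Module.End ℂ V)) := Set.range fun u => (Y u : Series n (Module.End ℂ V))
  have hS : S ⊆ fieldSpace d one S := by
    rintro _ ⟨u, rfl⟩
    refine ⟨(Y u).2, hderiv u, hcreation u, ?_⟩
    rintro _ ⟨v, rfl⟩
    exact hlocal u v
  have hgenS : ∀ P : Submodule ℂ V, one ∈ P →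
      (∀ (u : U) c, ∀ v ∈ P, (Y u : Series n (Module.End ℂ V)) c v ∈ P) → P = ⊤ :=
    fun P h1 h2 => hgen P h1 fun u m v hv => h2 u _ v hv
  obtain ⟨A, hA, hAY⟩ := exists_vertexAlgebra hvac hS fun P h1 h2 =>
    hgenS P h1 fun u => h2 _ ⟨u, rfl⟩
  have hAU : ∀ u : U, A.Y (u : V) = (Y u : Series n (Module.End ℂ V)) := fun u => by
    have h := hAY _ ⟨u, rfl⟩
    dsimp only at h
    rwa [hlimit] at h
  refine ⟨A, ⟨hA, hAU⟩, ?_⟩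
  rintro B ⟨hB, hBU⟩
  refine GnVertexAlgebra.eq_of_generators (U : Set V) (hB.trans hA.symm)
    (fun u hu => (hBU ⟨u, hu⟩).trans (hAU ⟨u, hu⟩).symm) fun P h1 h2 =>
    hgenS P (hB ▸ h1) fun u c v hv => ?_
  rw [← hBU]
  exact h2 u u.2 c v hv
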